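/- Let $d\ge 3$. A model consists of a Euclidean ordered field $Q$ (a linearly ordered field in which every positive element has a square root), a set $B$ of bodies, subsets $\mathrm{IOb}\subseteq \mathrm{Ob}\subseteq B$ (inertial observers, observers) and $\mathrm{Ph}\subseteq B$ (photons), and a worldview relation $W\subseteq \mathrm{Ob}\times B\times Q^d$. For $p=(p_1,\dots,p_d)\in Q^d$ put $p_\tau=p_1$, $p_\sigma=(p_2,\dots,p_d)$, and let $|\cdot|$ be Euclidean length. For observers $m,k$ let $ev_m(p)=\{b: W(m,b,p)\}$; let $Ev_m$ be the set of nonempty events $ev_m(p)$, $Cd_m=\{p: ev_m(p)\neq\emptyset\}$, $wl_m(b)=\{p: W(m,b,p)\}$, and $w^k_m=\{(p,q): ev_k(p)=ev_m(q)\ne\emptyset\}$. Write $w^k_m(p)$ for the unique $q$ with $(p,q)\in w^k_m$, $loc_m(e)$ for the unique $p$ with $ev_m(p)=e$, $time_m(e)=loc_m(e)_\tau$, $time_m(e,e')=|time_m(e)-time_m(e')|$, $dist_m(e,e')=|loc_m(e)_\sigma-loc_m(e')_\sigma|$, and $1^k_m=w^k_m(1,0,\dots,0)-w^k_m(0,\dots,0)$;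 an equation or inequality between such terms asserts in particular that they are defined. Let $e\sim_m e'$ mean that $e=ev_m(p)$, $e'=ev_m(q)$ for some $p,q$ with $p_\tau=q_\tau$. Consider the axioms: * **AxSelf$_0$**: for all $m\in\mathrm{Ob}$, $p\in Q^d$: $m\in ev_m(p)$ iff $p\in Cd_m$ and $p_\sigma=0$. * **AxPh**: for all $m\in\mathrm{IOb}$, $p,q\in Q^d$: $|p_\sigma-q_\sigma|=|p_\tau-q_\tau|$ iff $\mathrm{Ph}\cap ev_m(p)\cap ev_m(q)\neq\emptyset$. * **AxEv**: $Ev_m=Ev_k$ for all $m,k\in\mathrm{IOb}$. * **AxSymDist**: for all $m,k\in\mathrm{IOb}$ and $e_1,e_2\in Ev_m\cap Ev_k$: if $e_1\sim_m e_2$ and $e_1\sim_k e_2$, then $dist_m(e_1,e_2)=dist_k(e_1,e_2)$. * **AxLinTime**: for all $m,k\in\mathrm{IOb}$: $wl_m(k)=\{w^k_m(0,\dots,0)+\lambda 1^k_m:\lambda\in Q\}$, and $time_k(ev_m(p),ev_m(q))\cdot|1^k_m|=|p-q|$ for all $p,q\in wl_m(k)$. * **AxShift**: for all $m,k\in\mathrm{IOb}$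 and $p\in Cd_m$ there is $h\in\mathrm{IOb}$ with $h\in ev_m(p)$ and $1^k_m=1^h_m$. * **AxThExp**: for all $m\in\mathrm{IOb}$ and $p,q\in Q^d$ with $|p_\sigma-q_\sigma|<|p_\tau-q_\tau|$ there is $k\in\mathrm{IOb}$ with $k\in ev_m(p)\cap ev_m(q)$. * **CP** (clock paradox): for all $m,a,b,c\in\mathrm{IOb}$ and $e_a,e,e_c\in Ev_m$: if $a\in e_a\cap e$, $b\in e_a\cap e_c$, $c\in e\cap e_c$, $b\notin e$, and either $time_m(e_a)<time_m(e)<time_m(e_c)$ or $time_m(e_a)>time_m(e)>time_m(e_c)$, then $time_a(e_a,e)+time_c(e,e_c)<time_b(e_a,e_c)$. Let SpecRel$_0$ be $\{$AxSelf$_0$, AxPh, AxEv$\}$. Then: 1. CP holds in every model of SpecRel$_0$ + AxSymDist; but 2. there is a model in which SpecRel$_0$, AxLinTime, AxShift, AxThExp and CP hold and AxSymDist fails. Hence, over SpecRel$_0$, CP is strictly weaker than AxSymDist. -/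

import Mathlib

universe u v

namespace Kinematics

/-- A Euclidean ordered field: a linearly ordered field (given by the classes `Field`,
`LinearOrder`, `IsStrictOrderedRing`) in which every positive element has a square root. -/
class IsEuclideanOrderedField (Q : Type u) [Field Q] [LinearOrder Q] : Prop
    extends IsStrictOrderedRing Q where
  isSquare_of_pos : ∀ x : Q, 0 < x → IsSquare x

section Quantities

variable {Q : Type u} [Field Q] [LinearOrder Q]

open Classical in
/-- The nonnegative square root (with value `0` where there is none; it is only applied to sums
of squares). -/
noncomputable def sqrt (x : Q) : Q :=
  if h : ∃ y : Q, 0 ≤ y ∧ y ^ 2 = x then h.choose else 0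

theorem sqrt_spec [IsEuclideanOrderedField Q] {x : Q} (hx : 0 ≤ x) :
    0 ≤ sqrt x ∧ sqrt x ^ 2 = x := by
  have h : ∃ y : Q, 0 ≤ y ∧ y ^ 2 = x := by
    rcases hx.eq_or_lt with rfl | hx
    · exact ⟨0, le_rfl, by simp⟩
    · obtain ⟨y, hy⟩ := IsEuclideanOrderedField.isSquare_of_pos x hx
      exact ⟨|y|, abs_nonneg y, by rw [sq_abs, hy, sq]⟩
  unfold sqrt
  rw [dif_pos h]
  exact h.choose_spec

/-- Euclidean length of a finite tuple. -/
noncomputable def length {ι : Type} [Fintype ι] (x : ι → Q) : Q :=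
  sqrt (∑ i, x i ^ 2)

end Quantities

/-- The coordinate system `Q ^ d`; the coordinate with index `0` is time, the others are space. -/
abbrev Coord (Q : Type u) (d : ℕ) : Type u := Fin d → Q

section Coordinates

variable {Q : Type u} {d : ℕ} [NeZero d]

/-- Time component. -/
def timeComp (p : Coord Q d) : Q := p 0

/-- Space component. -/
def spaceComp (p : Coord Q d) : {i : Fin d // i ≠ 0} → Q := fun i => p i

/-- The vector `(1, 0, …, 0)`. -/
def unitTime [Field Q] : Coord Q d := Pi.single 0 1

end Coordinates

/-- A `d`-dimensional kinematical structure with quantities `Q` and bodies `B`: sets of observers,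
inertial observers and photons, and the worldview relation `W m b p`
("observer `m` coordinatizes body `b` at coordinate point `p`"). -/
structure Model (d : ℕ) (Q : Type u) (B : Type v) where
  Ob : Set B
  IOb : Set B
  Ph : Set B
  W : B → B → Coord Q d → Prop
  IOb_subset_Ob : IOb ⊆ Ob
  W_observer : ∀ m b p, W m b p → m ∈ Ob

namespace Model

variable {d : ℕ} {Q : Type u} {B : Type v}

section Basic

variable (M : Model d Q B)

/-- The event observed by `m` at `p`: the set of bodies `m` coordinatizes there. -/
def ev (m : B) (p : Coord Q d) : Set B := {b | M.W m b p}

/-- The set of nonempty events coordinatized by `m`. -/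
def Ev (m : B) : Set (Set B) := {e | e.Nonempty ∧ ∃ p, M.ev m p = e}

/-- The coordinate domain of `m`. -/
def Cd (m : B) : Set (Coord Q d) := {p | (M.ev m p).Nonempty}

/-- The world-line of the body `b` according to `m`. -/
def wl (m b : B) : Set (Coord Q d) := {p | M.W m b p}

/-- The worldview transformation between `k` and `m`, a binary relation. -/
def w (k m : B) (p q : Coord Q d) : Prop := M.ev k p = M.ev m q ∧ (M.ev k p).Nonempty

/-- "The value of the worldview transformation between `k` and `m` at `p` is defined and equals
`q`": `q` is the unique point related to `p`. -/
def wValue (k m : B) (p q : Coord Q d) : Prop :=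
  M.w k m p q ∧ ∀ q', M.w k m p q' → q' = q

/-- "The location of the event `e` according to `m` is defined and equals `p`": `p` is the unique
point at which `m` observes `e`. -/
def loc (m : B) (e : Set B) (p : Coord Q d) : Prop :=
  M.ev m p = e ∧ ∀ q, M.ev m q = e → q = p

end Basic

variable [NeZero d] [Field Q]

/-- "The time-unit vector of `k` according to `m` is defined and equals `x`". -/
def timeUnitVector (M : Model d Q B) (k m : B) (x : Coord Q d) : Prop :=
  ∃ p q, M.wValue k m 0 p ∧ M.wValue k m unitTime q ∧ x = q - p

/-- The events `e₁` and `e₂` are simultaneous for `m`. -/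
def simultaneous (M : Model d Q B) (m : B) (e₁ e₂ : Set B) : Prop :=
  ∃ p q, M.ev m p = e₁ ∧ M.ev m q = e₂ ∧ timeComp p = timeComp q

variable [LinearOrder Q] (M : Model d Q B)

/-- "The times of `e₁` and of `e₂` according to `m` are defined and the first is smaller". -/
def timeLT (m : B) (e₁ e₂ : Set B) : Prop :=
  ∃ p q, M.loc m e₁ p ∧ M.loc m e₂ q ∧ timeComp p < timeComp q

/-- "The time elapsed between `e₁` and `e₂` according to `m` is defined and equals `t`". -/
def elapsedTime (m : B) (e₁ e₂ : Set B) (t : Q) : Prop :=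
  ∃ p q, M.loc m e₁ p ∧ M.loc m e₂ q ∧ t = |timeComp p - timeComp q|

/-- "The spatial distance of `e₁` and `e₂` according to `m` is defined and equals `x`". -/
def distance (m : B) (e₁ e₂ : Set B) (x : Q) : Prop :=
  ∃ p q, M.loc m e₁ p ∧ M.loc m e₂ q ∧ x = length (spaceComp p - spaceComp q)

/-- An observer coordinatizes itself at a point iff the point is in its coordinate domain and has
zero space component. -/
def AxSelf₀ : Prop :=
  ∀ m ∈ M.Ob, ∀ p : Coord Q d, m ∈ M.ev m p ↔ p ∈ M.Cd m ∧ spaceComp p = 0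

/-- For every inertial observer there is a photon through two coordinate points iff their
difference has slope `1`. -/
def AxPh : Prop :=
  ∀ m ∈ M.IOb, ∀ p q : Coord Q d,
    length (spaceComp p - spaceComp q) = |timeComp p - timeComp q| ↔
      (M.Ph ∩ M.ev m p ∩ M.ev m q).Nonempty

/-- All inertial observers coordinatize the same events. -/
def AxEv : Prop :=
  ∀ m ∈ M.IOb, ∀ k ∈ M.IOb, M.Ev m = M.Ev k

/-- Basic special relativity without a symmetry axiom. -/
def SpecRel₀ : Prop := M.AxSelf₀ ∧ M.AxPh ∧ M.AxEv

/-- The symmetric distance axiom: inertial observers agree on the spatial distance of two events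
which are simultaneous for both of them. -/
def AxSymDist : Prop :=
  ∀ m ∈ M.IOb, ∀ k ∈ M.IOb, ∀ e₁ ∈ M.Ev m ∩ M.Ev k, ∀ e₂ ∈ M.Ev m ∩ M.Ev k,
    M.simultaneous m e₁ e₂ → M.simultaneous k e₁ e₂ →
      ∃ x, M.distance m e₁ e₂ x ∧ M.distance k e₁ e₂ x

/-- World-lines of inertial observers are lines and time elapses uniformly on them. -/
def AxLinTime : Prop :=
  ∀ m ∈ M.IOb, ∀ k ∈ M.IOb, ∃ o x : Coord Q d,
    M.wValue k m 0 o ∧ M.timeUnitVector k m x ∧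
    M.wl m k = {p | ∃ c : Q, p = o + c • x} ∧
    ∀ p ∈ M.wl m k, ∀ q ∈ M.wl m k,
      ∃ t, M.elapsedTime k (M.ev m p) (M.ev m q) t ∧ t * length x = length (p - q)

/-- If `m` observes an inertial observer with a certain time-unit vector, then at each point of its
coordinate domain it observes an inertial observer with the same time-unit vector. -/
def AxShift : Prop :=
  ∀ m ∈ M.IOb, ∀ k ∈ M.IOb, ∀ p ∈ M.Cd m, ∃ h ∈ M.IOb,
    h ∈ M.ev m p ∧ ∃ x, M.timeUnitVector k m x ∧ M.timeUnitVector h m x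

/-- Inertial observers can move in any direction at any speed slower than light. -/
def AxThExp : Prop :=
  ∀ m ∈ M.IOb, ∀ p q : Coord Q d,
    length (spaceComp p - spaceComp q) < |timeComp p - timeComp q| →
      ∃ k ∈ M.IOb, k ∈ M.ev m p ∩ M.ev m q

/-- `m` observes `a`, `b`, `c` in a clock paradox situation at the events `ea`, `e`, `ec`:
`b` goes from `ea` to `ec` avoiding `e`, while `a` goes from `ea` to `e` and `c` from `e` to `ec`. -/
def ClockParadoxSituation (m a b c : B) (ea e ec : Set B) : Prop :=
  a ∈ ea ∩ e ∧ b ∈ ea ∩ ec ∧ c ∈ e ∩ ec ∧ b ∉ e ∧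
    ((M.timeLT m ea e ∧ M.timeLT m e ec) ∨ (M.timeLT m e ea ∧ M.timeLT m ec e))

/-- The clocks of `a` and `c` together measure less time than the clock of `b`. -/
def TravellersTimeLT (a b c : B) (ea e ec : Set B) : Prop :=
  ∃ ta tc tb, M.elapsedTime a ea e ta ∧ M.elapsedTime c e ec tc ∧ M.elapsedTime b ea ec tb ∧
    ta + tc < tb

/-- The clock paradox. -/
def CP : Prop :=
  ∀ m ∈ M.IOb, ∀ a ∈ M.IOb, ∀ b ∈ M.IOb, ∀ c ∈ M.IOb,
    ∀ ea ∈ M.Ev m, ∀ e ∈ M.Ev m, ∀ ec ∈ M.Ev m,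
      M.ClockParadoxSituation m a b c ea e ec → M.TravellersTimeLT a b c ea e ec

end Model

end Kinematics

/-! For part 1, `AxPh` makes each event determine its light cone, hence its point. With `AxEv`,
every worldview transformation is therefore a bijection preserving lightlike separation both ways.
An Alexandrov–Zeeman argument, valid over any ordered field once `d ≥ 3`, shows that such a map is a
translation composed with a semilinear similarity of the Minkowski form
(`NullPreserving.map_add_sub`, `NullPreserving.exists_ringHom`). `AxSymDist`, applied to a vector
that is spatial on both sides, removes the field endomorphism and the scale factor
(`NullPreserving.linear_and_mink_eq`). So clocks measure Minkowski length, and CP is the strict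
reversed triangle inequality (`sqrt_mink_add_lt_of_avoid`).

For part 2, CP needs only a strictly superadditive clock, not an invariant one. In a fixed reference
system, let clocks measure `√⟨x,x⟩ + |x₀|`. The second term is additive on vectors of equal time
orientation, so the strict inequality survives. The first four axioms after the symmetry axiom is
dropped are insensitive to rescaling the units of each observer, so all frames normalized by this
clock form a model. The ratio of the clock to Minkowski length depends on velocity; hence two frames
can share a spatial vector orthogonal to both time axes and disagree on its length. -/

namespace Kinematics

/-! ### Algebra of the Minkowski form over an ordered field. -/

section MinkowskiForm

variable {Q : Type*} [Field Q] {d : ℕ} [NeZero d]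

/-- The Minkowski form on `Q ^ d`. -/
def mink : LinearMap.BilinForm Q (Coord Q d) :=
  LinearMap.mk₂ Q (fun x y => x 0 * y 0 - ∑ i : {i : Fin d // i ≠ 0}, x i * y i)
    (fun x x' y => by simp only [Pi.add_apply, add_mul, Finset.sum_add_distrib]; ring)
    (fun c x y => by
      simp only [Pi.smul_apply, smul_eq_mul, mul_assoc, ← Finset.mul_sum, mul_sub])
    (fun x y y' => by simp only [Pi.add_apply, mul_add, Finset.sum_add_distrib]; ring)
    (fun c x y => by
      simp only [Pi.smul_apply, smul_eq_mul, mul_left_comm _ c, ← Finset.mul_sum, mul_sub])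

theorem mink_apply (x y : Coord Q d) :
    mink x y = x 0 * y 0 - ∑ i : {i : Fin d // i ≠ 0}, x i * y i := rfl

theorem mink_comm (x y : Coord Q d) : mink x y = mink y x := by
  simp only [mink_apply, mul_comm]

theorem mink_add_self (x y : Coord Q d) :
    mink (x + y) (x + y) = mink x x + 2 * mink x y + mink y y := by
  simp only [map_add, LinearMap.add_apply, mink_comm y x]; ring

theorem mink_sub_self (x y : Coord Q d) :
    mink (x - y) (x - y) = mink x x - 2 * mink x y + mink y y := by
  simp only [map_sub, LinearMap.sub_apply, mink_comm y x]; ring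

theorem mink_smul_self (c : Q) (x : Coord Q d) : mink (c • x) (c • x) = c ^ 2 * mink x x := by
  simp only [map_smul, LinearMap.smul_apply, smul_eq_mul]; ring

theorem mink_sub_self_comm (x y : Coord Q d) :
    mink (x - y) (x - y) = mink (y - x) (y - x) := by
  rw [mink_sub_self, mink_sub_self, mink_comm x y]; ring

theorem mink_unitTime_left (x : Coord Q d) : mink unitTime x = x 0 := by
  have : ∀ i : {i : Fin d // i ≠ 0}, (unitTime : Coord Q d) i = 0 := fun i => by
    simp [unitTime, i.2]
  simp only [mink_apply, this, zero_mul, Finset.sum_const_zero]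
  simp [unitTime]

theorem mink_unitTime : mink (unitTime : Coord Q d) unitTime = 1 := by
  rw [mink_unitTime_left]; simp [unitTime]

theorem mink_single_right {i : Fin d} (hi : i ≠ 0) (x : Coord Q d) (c : Q) :
    mink x (Pi.single i c) = - (x i * c) := by
  rw [mink_apply, Finset.sum_eq_single ⟨i, hi⟩]
  · simp [hi.symm]
  · intro j _ hj
    have : (j : Fin d) ≠ i := fun h => hj (Subtype.ext h)
    simp [this]
  · simp

variable [LinearOrder Q] [IsStrictOrderedRing Q]

theorem eq_zero_of_mink_self_eq_zero {x : Coord Q d} (h0 : x 0 = 0) (h : mink x x = 0) :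
    x = 0 := by
  rw [mink_apply, h0, mul_zero, zero_sub, neg_eq_zero,
    Finset.sum_eq_zero_iff_of_nonneg (fun i _ => mul_self_nonneg _)] at h
  funext i
  by_cases hi : i = 0
  · rw [hi, h0]; rfl
  · exact mul_self_eq_zero.1 (h ⟨i, hi⟩ (Finset.mem_univ _))

theorem mink_self_nonpos {x : Coord Q d} (h0 : x 0 = 0) : mink x x ≤ 0 := by
  rw [mink_apply, h0, mul_zero, zero_sub, neg_nonpos]
  exact Finset.sum_nonneg fun i _ => mul_self_nonneg _

theorem time_ne_zero {n : Coord Q d} (hn : mink n n = 0) (hn0 : n ≠ 0) : n 0 ≠ 0 :=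
  fun h => hn0 (eq_zero_of_mink_self_eq_zero h hn)

/-- Orthogonal null vectors are parallel. -/
theorem exists_eq_smul_of_null {x y : Coord Q d} (hx : mink x x = 0) (hx0 : x ≠ 0)
    (hy : mink y y = 0) (hxy : mink x y = 0) : ∃ c : Q, y = c • x := by
  have h0 := time_ne_zero hx hx0
  -- With this factor the difference has zero time component and is still null, so it vanishes.
  refine ⟨y 0 / x 0, sub_eq_zero.1 (eq_zero_of_mink_self_eq_zero ?_ ?_)⟩
  · simp [h0]
  · rw [mink_sub_self, mink_smul_self, map_smul, mink_comm y x, hx, hy, hxy]; simp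

/-- A nonzero vector orthogonal to a timelike one is spacelike. -/
theorem mink_self_neg_of_orthogonal {x z : Coord Q d} (hx : 0 < mink x x) (hxz : mink x z = 0)
    (hz : z ≠ 0) : mink z z < 0 := by
  have cs := Finset.sum_mul_sq_le_sq_mul_sq (Finset.univ : Finset {i : Fin d // i ≠ 0})
    (fun i => x i) (fun i => z i)
  have hS : 0 ≤ ∑ i : {i : Fin d // i ≠ 0}, z i ^ 2 := Finset.sum_nonneg fun i _ => sq_nonneg _
  have hzS : z 0 = 0 → (∑ i : {i : Fin d // i ≠ 0}, z i ^ 2) ≠ 0 := fun h0 h => hz <|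
    eq_zero_of_mink_self_eq_zero h0 <| by
      simp only [mink_apply, ← sq, h, h0]; simp
  rw [mink_apply] at hx hxz ⊢
  simp only [← sq] at hx ⊢
  -- Orthogonality replaces the spatial product in Cauchy–Schwarz by `x 0 * z 0`.
  rw [← sub_eq_zero.1 hxz] at cs
  by_contra! hcon
  by_cases h0 : z 0 = 0
  · rw [h0] at hcon
    exact hzS h0 (le_antisymm (by linarith) hS)
  · have : 0 < z 0 ^ 2 := by positivity
    have hT : 0 ≤ ∑ i : {i : Fin d // i ≠ 0}, x i ^ 2 := Finset.sum_nonneg fun i _ => sq_nonneg _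
    nlinarith

/-- The strict reversed Cauchy-Schwarz inequality. -/
theorem mink_mul_mink_lt {x y : Coord Q d} (hx : 0 < mink x x) (hxy : ∀ c : Q, y ≠ c • x) :
    mink x x * mink y y < mink x y ^ 2 := by
  -- The component of `y` orthogonal to `x` is nonzero, hence spacelike.
  have h := mink_self_neg_of_orthogonal (z := y - (mink x y / mink x x) • x) hx
    (by rw [map_sub, map_smul, smul_eq_mul, div_mul_cancel₀ _ hx.ne', sub_self])
    (sub_ne_zero.2 (hxy _))
  rw [mink_sub_self, mink_smul_self, map_smul, mink_comm y x, smul_eq_mul] at h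
  have h2 : mink x x * (mink y y - 2 * (mink x y / mink x x * mink x y) +
      (mink x y / mink x x) ^ 2 * mink x x) = mink x x * mink y y - mink x y ^ 2 := by
    field_simp; ring
  nlinarith [mul_neg_of_pos_of_neg hx h]

theorem time_ne_zero_of_pos {x : Coord Q d} (hx : 0 < mink x x) : x 0 ≠ 0 :=
  fun h => (mink_self_nonpos h).not_gt hx

/-- Two timelike vectors have the same time orientation iff their product is positive. -/
theorem mink_pos_iff {x y : Coord Q d} (hx : 0 < mink x x) (hy : 0 < mink y y) :
    0 < mink x y ↔ 0 < x 0 * y 0 := by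
  have cs := Finset.sum_mul_sq_le_sq_mul_sq (Finset.univ : Finset {i : Fin d // i ≠ 0})
    (fun i => x i) (fun i => y i)
  have hX : 0 ≤ ∑ i : {i : Fin d // i ≠ 0}, x i ^ 2 := Finset.sum_nonneg fun i _ => sq_nonneg _
  have hY : 0 ≤ ∑ i : {i : Fin d // i ≠ 0}, y i ^ 2 := Finset.sum_nonneg fun i _ => sq_nonneg _
  rw [mink_apply] at hx hy ⊢
  simp only [← sq] at hx hy
  -- The product of the time components dominates the spatial product, so it alone decides the sign.
  have h : (∑ i : {i : Fin d // i ≠ 0}, x i * y i) ^ 2 < (x 0 * y 0) ^ 2 := by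
    rw [mul_pow]; nlinarith
  rw [sq_lt_sq] at h
  constructor
  · intro h1
    by_contra! h2
    rw [abs_of_nonpos h2] at h
    linarith [neg_abs_le (∑ i : {i : Fin d // i ≠ 0}, x i * y i)]
  · intro h2
    rw [abs_of_pos h2] at h
    linarith [le_abs_self (∑ i : {i : Fin d // i ≠ 0}, x i * y i)]

/-- In dimension at least three each vector is orthogonal to a nonzero purely spatial one. -/
theorem exists_spatial_orthogonal (hd : 3 ≤ d) (n : Coord Q d) :
    ∃ e : Coord Q d, e 0 = 0 ∧ mink n e = 0 ∧ mink e e ≠ 0 := by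
  suffices h : ∃ e : Coord Q d, e 0 = 0 ∧ mink n e = 0 ∧ e ≠ 0 by
    obtain ⟨e, h0, h1, h2⟩ := h
    exact ⟨e, h0, h1, fun h => h2 (eq_zero_of_mink_self_eq_zero h0 h)⟩
  let i : Fin d := ⟨1, by omega⟩
  let j : Fin d := ⟨2, by omega⟩
  have hi : i ≠ 0 := by simp [i, Fin.ext_iff]
  have hj : j ≠ 0 := by simp [j, Fin.ext_iff]
  have hij : i ≠ j := by simp [i, j, Fin.ext_iff]
  by_cases h : n i = 0
  · refine ⟨Pi.single i 1, by simp [hi.symm], by simp [mink_single_right hi, h], by simp⟩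
  · refine ⟨Pi.single i (n j) + Pi.single j (-n i), by simp [hi.symm, hj.symm], ?_, fun h' => h ?_⟩
    · rw [map_add, mink_single_right hi, mink_single_right hj]; ring
    · simpa [hij.symm] using congrFun h' j

/-- Each vector is a sum of two null vectors. -/
theorem exists_null_add_null (hd : 3 ≤ d) (x : Coord Q d) :
    ∃ n n' : Coord Q d, mink n n = 0 ∧ mink n' n' = 0 ∧ x = n + n' := by
  -- If `n` is null and not orthogonal to `x`, one multiple of `n` makes the remainder null.
  -- Candidates are the sums of the time unit and plus or minus a spatial unit; all of them are
  -- orthogonal to `x` only if `x = 0`.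
  suffices h : ∃ n : Coord Q d, mink n n = 0 ∧ mink n x ≠ 0 ∨ x = 0 by
    obtain ⟨n, ⟨hn, hnx⟩ | rfl⟩ := h
    · refine ⟨(mink x x / (2 * mink n x)) • n, x - (mink x x / (2 * mink n x)) • n, ?_, ?_, ?_⟩
      · rw [mink_smul_self, hn, mul_zero]
      · rw [mink_sub_self, mink_smul_self, map_smul, hn, mink_comm x n, smul_eq_mul]
        field_simp; ring
      · abel
    · exact ⟨0, 0, by simp, by simp, by simp⟩
  have hnull : ∀ i : Fin d, i ≠ 0 → ∀ c : Q, c ^ 2 = 1 →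
      mink (unitTime + Pi.single i c : Coord Q d) (unitTime + Pi.single i c) = 0 := by
    intro i hi c hc
    rw [mink_add_self, mink_unitTime, mink_unitTime_left, mink_single_right hi]
    simp [hi.symm, ← sq, hc]
  have hval : ∀ i : Fin d, i ≠ 0 → ∀ c : Q,
      mink (unitTime + Pi.single i c : Coord Q d) x = x 0 - x i * c := by
    intro i hi c
    rw [map_add, LinearMap.add_apply, mink_unitTime_left, mink_comm, mink_single_right hi]; ring
  have hex : ∀ i : Fin d, i ≠ 0 → x 0 ≠ 0 ∨ x i ≠ 0 →
      ∃ n : Coord Q d, mink n n = 0 ∧ mink n x ≠ 0 ∨ x = 0 := by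
    intro i hi hx
    by_cases h : x 0 - x i * 1 = 0
    · refine ⟨_, Or.inl ⟨hnull i hi (-1) (by ring), ?_⟩⟩
      rw [hval i hi]
      intro h'
      rcases hx with hx | hx <;> apply hx <;> linarith
    · exact ⟨_, Or.inl ⟨hnull i hi 1 (by ring), by rwa [hval i hi]⟩⟩
  by_cases h : x 0 = 0
  · by_cases h' : ∃ i : Fin d, i ≠ 0 ∧ x i ≠ 0
    · obtain ⟨i, hi, hxi⟩ := h'
      exact hex i hi (Or.inr hxi)
    · push Not at h'
      refine ⟨0, Or.inr (funext fun i => ?_)⟩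
      by_cases hi : i = 0
      · rw [hi, h]; rfl
      · exact h' i hi
  · exact hex ⟨1, by omega⟩ (by simp [Fin.ext_iff]) (Or.inl h)

/-- Supplies a null partner not orthogonal to `n`: subtracting `c • n` from the time unit changes
its square to `1 - 2 * c * n 0`, which fixes `c`. -/
theorem exists_null_mink_eq_time {n : Coord Q d} (hn : mink n n = 0) (hn0 : n ≠ 0) :
    ∃ m : Coord Q d, mink m m = 0 ∧ mink n m = n 0 := by
  have ht := time_ne_zero hn hn0
  refine ⟨unitTime - (1 / (2 * n 0)) • n, ?_, ?_⟩
  · rw [mink_sub_self, mink_smul_self, mink_unitTime, map_smul, mink_unitTime_left, hn, smul_eq_mul]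
    field_simp; ring
  · rw [map_sub, map_smul, hn, mink_comm, mink_unitTime_left]; simp

/-- A point is determined by its light cone. -/
theorem eq_of_null_iff {p q : Coord Q d}
    (h : ∀ r, mink (p - r) (p - r) = 0 ↔ mink (q - r) (q - r) = 0) : p = q := by
  by_contra hpq
  have hn : mink (p - q) (p - q) = 0 := (h q).2 (by simp)
  obtain ⟨m, hm, hnm⟩ := exists_null_mink_eq_time hn (sub_ne_zero.2 hpq)
  have h1 := (h (q + m)).2 (by simpa using hm)
  rw [← sub_sub, mink_sub_self, hn, hm, hnm] at h1
  exact time_ne_zero hn (sub_ne_zero.2 hpq) (by linarith)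

end MinkowskiForm

/-! ### Euclidean length and the reversed triangle inequality. -/

section Length

variable {Q : Type*} [Field Q] [LinearOrder Q] [IsEuclideanOrderedField Q]

theorem sqrt_nonneg {x : Q} (hx : 0 ≤ x) : 0 ≤ sqrt x := (sqrt_spec hx).1

theorem sq_sqrt {x : Q} (hx : 0 ≤ x) : sqrt x ^ 2 = x := (sqrt_spec hx).2

theorem sqrt_eq_iff {x y : Q} (hx : 0 ≤ x) (hy : 0 ≤ y) : sqrt x = y ↔ x = y ^ 2 := by
  rw [← sq_eq_sq₀ (sqrt_nonneg hx) hy, sq_sqrt hx]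

theorem sqrt_sq {x : Q} : sqrt (x ^ 2) = |x| := by
  rw [sqrt_eq_iff (sq_nonneg x) (abs_nonneg x), sq_abs]

theorem sqrt_inj {x y : Q} (hx : 0 ≤ x) (hy : 0 ≤ y) : sqrt x = sqrt y ↔ x = y := by
  rw [sqrt_eq_iff hx (sqrt_nonneg hy), sq_sqrt hy]

theorem sqrt_pos {x : Q} (hx : 0 < x) : 0 < sqrt x :=
  (sqrt_nonneg hx.le).lt_of_ne fun h => by
    have := sq_sqrt hx.le
    rw [← h] at this
    simp at this
    exact hx.ne this

theorem sum_sq_nonneg {ι : Type} [Fintype ι] (x : ι → Q) : 0 ≤ ∑ i, x i ^ 2 :=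
  Finset.sum_nonneg fun _ _ => sq_nonneg _

theorem length_smul {ι : Type} [Fintype ι] (c : Q) (x : ι → Q) :
    length (c • x) = |c| * length x := by
  unfold length
  rw [sqrt_eq_iff (sum_sq_nonneg _) (mul_nonneg (abs_nonneg c) (sqrt_nonneg (sum_sq_nonneg _))),
    mul_pow, sq_sqrt (sum_sq_nonneg _), sq_abs, Finset.mul_sum]
  simp [mul_pow]

variable {d : ℕ} [NeZero d]

omit [LinearOrder Q] [IsEuclideanOrderedField Q] in
theorem sum_sq_spaceComp (p q : Coord Q d) :
    ∑ i, (spaceComp p - spaceComp q) i ^ 2 =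
      (timeComp p - timeComp q) ^ 2 - mink (p - q) (p - q) := by
  simp only [mink_apply, spaceComp, timeComp, Pi.sub_apply, sq]; ring

theorem length_eq_iff_null (p q : Coord Q d) :
    length (spaceComp p - spaceComp q) = |timeComp p - timeComp q| ↔
      mink (p - q) (p - q) = 0 := by
  unfold length
  rw [sqrt_eq_iff (sum_sq_nonneg _) (abs_nonneg _), sq_abs, sum_sq_spaceComp]
  constructor <;> intro h <;> linarith

theorem length_lt_iff_timelike (p q : Coord Q d) :
    length (spaceComp p - spaceComp q) < |timeComp p - timeComp q| ↔
      0 < mink (p - q) (p - q) := by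
  unfold length
  rw [← sq_lt_sq₀ (sqrt_nonneg (sum_sq_nonneg _)) (abs_nonneg _), sq_abs,
    sq_sqrt (sum_sq_nonneg _), sum_sq_spaceComp]
  constructor <;> intro h <;> linarith

omit [IsEuclideanOrderedField Q] in
theorem length_spaceComp_eq {p q : Coord Q d} (h : timeComp p = timeComp q) :
    length (spaceComp p - spaceComp q) = sqrt (- mink (p - q) (p - q)) := by
  unfold length
  rw [sum_sq_spaceComp, h]; simp

/-- The strict reversed triangle inequality. -/
theorem sqrt_mink_add_lt {x y : Coord Q d} (hx : 0 < mink x x) (hy : 0 < mink y y)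
    (ho : 0 < mink x y) (hxy : ∀ c : Q, y ≠ c • x) :
    sqrt (mink x x) + sqrt (mink y y) < sqrt (mink (x + y) (x + y)) := by
  have hs : 0 < mink (x + y) (x + y) := by rw [mink_add_self]; linarith
  have h1 := sq_sqrt hx.le
  have h2 := sq_sqrt hy.le
  have h3 := mink_mul_mink_lt hx hxy
  have p1 := sqrt_pos hx
  have p2 := sqrt_pos hy
  have h4 : sqrt (mink x x) * sqrt (mink y y) < mink x y := by
    rw [← sq_lt_sq₀ (by positivity) ho.le, mul_pow, h1, h2]; exact h3
  rw [← sq_lt_sq₀ (by positivity) (sqrt_nonneg hs.le), sq_sqrt hs.le, mink_add_self]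
  nlinarith

/-- The travelling twin's path is shorter. -/
theorem sqrt_mink_add_lt_of_avoid {A E C : Coord Q d} (h₁ : 0 < mink (E - A) (E - A))
    (h₂ : 0 < mink (C - E) (C - E)) (ho : 0 < mink (E - A) (C - E))
    (havoid : ∀ t : Q, E ≠ A + t • (C - A)) :
    sqrt (mink (E - A) (E - A)) + sqrt (mink (C - E) (C - E)) <
      sqrt (mink (C - A) (C - A)) := by
  rw [← sub_add_sub_cancel' E A C]
  refine sqrt_mink_add_lt h₁ h₂ ho fun c hc => ?_
  -- If the legs were parallel, equal time orientation would make `c` positive and put `E` on the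
  -- line from `A` to `C` at parameter `1 / (1 + c)`.
  have hc0 : 0 < c := by
    rw [hc, map_smul, smul_eq_mul] at ho
    exact pos_of_mul_pos_left ho h₁.le
  apply havoid (1 + c)⁻¹
  rw [← sub_add_sub_cancel' E A C, hc, show E - A + c • (E - A) = (1 + c) • (E - A) by module,
    smul_smul, inv_mul_cancel₀ (by positivity), one_smul, add_sub_cancel]

theorem mink_self_of_spaceComp_eq {p q : Coord Q d} (h : spaceComp p = spaceComp q) :
    mink (p - q) (p - q) = (timeComp p - timeComp q) ^ 2 := by
  have := sum_sq_spaceComp p q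
  rw [h] at this
  simp only [sub_self, Pi.zero_apply, ne_eq, OfNat.ofNat_ne_zero, not_false_eq_true, zero_pow,
    Finset.sum_const_zero] at this
  linarith

omit [LinearOrder Q] [IsEuclideanOrderedField Q] in
theorem spaceComp_eq_zero_iff {p : Coord Q d} : spaceComp p = 0 ↔ ∃ c : Q, p = c • unitTime := by
  constructor
  · intro h
    refine ⟨p 0, funext fun i => ?_⟩
    by_cases hi : i = 0
    · simp [hi, unitTime]
    · have : p i = 0 := congrFun h ⟨i, hi⟩
      simp [unitTime, hi, this]
  · rintro ⟨c, rfl⟩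
    funext i
    simp [spaceComp, unitTime, i.2]

end Length

/-! ### Bijections preserving lightlike separation are additive up to translation. -/

section NullPreserving

variable {Q : Type*} [Field Q] {d : ℕ} [NeZero d]

/-- A bijection preserving lightlike separation in both directions. -/
def NullPreserving (f : Coord Q d ≃ Coord Q d) : Prop :=
  ∀ p q, mink (p - q) (p - q) = 0 ↔ mink (f p - f q) (f p - f q) = 0

namespace NullPreserving

variable {f : Coord Q d ≃ Coord Q d} (hf : NullPreserving f)
include hf

theorem symm : NullPreserving f.symm := fun p q => by
  simpa using (hf (f.symm p) (f.symm q)).symm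

theorem map_null {n : Coord Q d} (p : Coord Q d) (hn : mink n n = 0) :
    mink (f (p + n) - f p) (f (p + n) - f p) = 0 :=
  (hf _ _).1 (by simpa using hn)

omit [NeZero d] hf in
theorem map_ne_zero {n : Coord Q d} (p : Coord Q d) (hn0 : n ≠ 0) :
    f (p + n) - f p ≠ 0 := by
  simpa [sub_eq_zero] using hn0

variable [LinearOrder Q] [IsStrictOrderedRing Q]

/-- Light lines are mapped into light lines. -/
theorem map_line {n : Coord Q d} (hn : mink n n = 0) (hn0 : n ≠ 0) (p : Coord Q d) (c : Q) :
    ∃ c' : Q, f (p + c • n) = f p + c' • (f (p + n) - f p) := by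
  have h1 := hf.map_null p hn
  have h2 := hf.map_null p (n := c • n) (by rw [mink_smul_self, hn, mul_zero])
  -- Three pairwise lightlike separated points: the two image vectors from `f p` are null with null
  -- difference, so orthogonal, so parallel.
  have h3 := (hf (p + c • n) (p + n)).1 (by
    rw [show p + c • n - (p + n) = (c - 1) • n by rw [sub_smul]; simp,
      mink_smul_self, hn, mul_zero])
  rw [show f (p + c • n) - f (p + n) = (f (p + c • n) - f p) - (f (p + n) - f p) by abel,
    mink_sub_self, h1, h2] at h3
  obtain ⟨c', hc'⟩ := exists_eq_smul_of_null h1 (map_ne_zero p hn0) h2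
    (by rw [mink_comm]; linarith)
  exact ⟨c', by rw [← hc']; abel⟩

/-- Light lines are mapped onto light lines. -/
theorem map_line_surj {n : Coord Q d} (hn : mink n n = 0) (hn0 : n ≠ 0) (p : Coord Q d) (c : Q) :
    ∃ c' : Q, f (p + c' • n) = f p + c • (f (p + n) - f p) := by
  obtain ⟨c', hc'⟩ := hf.symm.map_line (hf.map_null p hn) (map_ne_zero p hn0) (f p) c
  rw [f.symm_apply_eq] at hc'
  exact ⟨c', by simpa using hc'.symm⟩

/-- Suppose the image directions are not orthogonal. Then some point of the first line has its image
orthogonal, relative to `f q`, to the second direction, so that image is null separated from all or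
none of the second image line. Before mapping, the square of the separation is a nonconstant affine
function of the parameter, so exactly one point of the second line is null separated from it. -/
theorem map_parallel_of_ne {n p q : Coord Q d} (hn : mink n n = 0) (hn0 : n ≠ 0)
    (h : mink (p - q) n ≠ 0) : ∃ c : Q, f (q + n) - f q = c • (f (p + n) - f p) := by
  refine exists_eq_smul_of_null (hf.map_null p hn) (map_ne_zero p hn0) (hf.map_null q hn) ?_
  by_contra hne
  set n₁ := f (p + n) - f p with hn₁
  set n₂ := f (q + n) - f q with hn₂
  have hn₂n : mink n₂ n₂ = 0 := hf.map_null q hn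
  obtain ⟨c, hc⟩ := hf.map_line_surj hn hn0 p (- mink (f p - f q) n₂ / mink n₁ n₂)
  rw [← hn₁] at hc
  have horth : mink (f (p + c • n) - f q) n₂ = 0 := by
    rw [hc, add_sub_right_comm, map_add, LinearMap.add_apply, map_smul, LinearMap.smul_apply,
      smul_eq_mul, div_mul_cancel₀ _ hne, add_neg_cancel]
  have key : ∀ t : Q, mink (p + c • n - (q + t • n)) (p + c • n - (q + t • n)) =
      mink (p - q) (p - q) + 2 * (c - t) * mink (p - q) n := fun t => by
    rw [show p + c • n - (q + t • n) = (p - q) + (c - t) • n by rw [sub_smul]; abel,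
      mink_add_self, mink_smul_self, map_smul, hn, smul_eq_mul]
    ring
  have key' : ∀ t : Q, mink (f (p + c • n) - (f q + t • n₂)) (f (p + c • n) - (f q + t • n₂)) =
      mink (f (p + c • n) - f q) (f (p + c • n) - f q) := fun t => by
    rw [← sub_sub, mink_sub_self, mink_smul_self, map_smul, horth, hn₂n]
    simp
  have hall : ∀ s t : Q, mink (p - q) (p - q) + 2 * (c - s) * mink (p - q) n = 0 →
      mink (p - q) (p - q) + 2 * (c - t) * mink (p - q) n = 0 := by
    intro s t hs
    rw [← key, hf] at hs ⊢
    obtain ⟨s', hs'⟩ := hf.map_line hn hn0 q s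
    obtain ⟨t', ht'⟩ := hf.map_line hn hn0 q t
    rw [hs', ← hn₂, key'] at hs
    rw [ht', ← hn₂, key', hs]
  have h0 : mink (p - q) (p - q) +
      2 * (c - (c + mink (p - q) (p - q) / (2 * mink (p - q) n))) * mink (p - q) n = 0 := by
    field_simp; ring
  have h1 := hall _ c h0
  have h2 := hall _ (c - 1) h0
  apply h
  linarith

/-- Parallel light lines are mapped to parallel light lines. -/
theorem map_parallel {n : Coord Q d} (hn : mink n n = 0) (hn0 : n ≠ 0) (p q : Coord Q d) :
    ∃ c : Q, f (q + n) - f q = c • (f (p + n) - f p) := by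
  by_cases h : mink (p - q) n = 0
  · have ht := time_ne_zero hn hn0
    -- When the two lines lie in a common null hyperplane, pass through a third line shifted off it
    -- by the time unit.
    obtain ⟨c₁, h₁⟩ := hf.map_parallel_of_ne (p := p) (q := p + unitTime) hn hn0
      (by simpa [mink_unitTime_left] using ht)
    obtain ⟨c₂, h₂⟩ := hf.map_parallel_of_ne (p := p + unitTime) (q := q) hn hn0
      (by rw [add_sub_right_comm, map_add, LinearMap.add_apply, h, mink_unitTime_left, zero_add]
          exact ht)
    exact ⟨c₂ * c₁, by rw [h₂, h₁, mul_smul]⟩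
  · exact hf.map_parallel_of_ne hn hn0 h

/-- Parallelograms with lightlike sides are mapped to parallelograms. -/
theorem map_parallelogram {n n' : Coord Q d} (hn : mink n n = 0) (hn' : mink n' n' = 0)
    (h : mink n n' ≠ 0) (p : Coord Q d) :
    f (p + n' + n) - f (p + n') = f (p + n) - f p := by
  have hn0 : n ≠ 0 := by rintro rfl; simp at h
  have hn0' : n' ≠ 0 := by rintro rfl; simp at h
  obtain ⟨a, ha⟩ := hf.map_parallel hn hn0 p (p + n')
  obtain ⟨b, hb⟩ := hf.map_parallel hn' hn0' p (p + n)
  have hnull := hf.map_null p hn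
  have hnull' := hf.map_null p hn'
  -- Orthogonal image sides would make the opposite corners null separated, and hence `n` and `n'`
  -- orthogonal.
  have hne : mink (f (p + n) - f p) (f (p + n') - f p) ≠ 0 := by
    intro h0
    have h1 : mink (f (p + n) - f (p + n')) (f (p + n) - f (p + n')) = 0 := by
      rw [← sub_sub_sub_cancel_right _ _ (f p), mink_sub_self, hnull, hnull', h0]; simp
    rw [← hf, add_sub_add_left_eq_sub, mink_sub_self, hn, hn'] at h1
    apply h; linarith
  have e1 : f (p + n' + n) = f (p + n') + a • (f (p + n) - f p) := by rw [← ha]; abel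
  have e2 : f (p + n' + n) = f (p + n) + b • (f (p + n') - f p) := by
    rw [← hb, add_right_comm]; abel
  set x := f (p + n) - f p
  set y := f (p + n') - f p
  have e3 : (a - 1) • x = (b - 1) • y := by
    have hx : f (p + n) = f p + x := by simp [x]
    have hy : f (p + n') = f p + y := by simp [y]
    have : y + a • x = x + b • y := by
      rw [e1, hx, hy, add_assoc, add_assoc] at e2
      exact add_left_cancel e2
    rw [sub_smul, sub_smul, one_smul, one_smul, sub_eq_sub_iff_add_eq_add, add_comm, this, add_comm]
  have e4 := congrArg (fun z => mink z y) e3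
  simp only [map_smul, LinearMap.smul_apply, hnull', smul_eq_mul, mul_zero] at e4
  rw [ha, sub_eq_zero.1 ((mul_eq_zero.1 e4).resolve_right hne), one_smul]

/-- The increment of `f` along a null vector does not depend on the base point. -/
theorem map_add_null_sub (hd : 3 ≤ d) {n : Coord Q d} (hn : mink n n = 0) (p x : Coord Q d) :
    f (p + x + n) - f (p + x) = f (p + n) - f p := by
  by_cases hn0 : n = 0
  · simp [hn0]
  have ht := time_ne_zero hn hn0
  -- The translations that leave the increment along `n` unchanged at every base point. Null vectors
  -- not orthogonal to `n` belong to it by the parallelogram lemma; the rest of the proof shows that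
  -- they generate everything.
  let S : AddSubgroup (Coord Q d) :=
    { carrier := {x | ∀ p, f (p + x + n) - f (p + x) = f (p + n) - f p}
      zero_mem' := fun p => by simp
      add_mem' := fun {x y} hx hy p => by rw [← add_assoc, hy, hx]
      neg_mem' := fun {x} hx p => by rw [← hx (p + -x), neg_add_cancel_right] }
  have hS : ∀ x, mink x x = 0 → mink n x ≠ 0 → x ∈ S := fun x hx hnx p =>
    hf.map_parallelogram hn hx hnx p
  obtain ⟨e, -, hne, hee⟩ := exists_spatial_orthogonal hd n
  obtain ⟨m, hm, hnm⟩ := exists_null_mink_eq_time hn hn0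
  have hline : ∀ c : Q, c • n ∈ S := by
    intro c
    by_cases hc : c = 0
    · simp [hc]
    -- Chosen so that both vectors in `hmem`, for `s = 1` and `s = -1`, are null. In their sum the
    -- `e` terms cancel, and removing `2 • (b • m)` leaves exactly `c • n`.
    let b := - mink e e / (c * n 0)
    have hb : b ≠ 0 := by simp [b, hee, hc, ht]
    have hmem : ∀ s : Q, s ^ 2 = 1 →
        b • m + s • e + (c / 2 - s * mink m e / n 0) • n ∈ S := by
      intro s hs
      apply hS
      · rw [mink_add_self, mink_add_self]
        simp only [map_smul, map_add, LinearMap.add_apply, LinearMap.smul_apply, hm, hn,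
          mink_comm m n, mink_comm e n, hnm, hne, smul_eq_mul]
        have : s * (s * mink e e) = mink e e := by rw [← mul_assoc, ← sq, hs, one_mul]
        rw [this]
        simp only [b]
        field_simp
        ring
      · simp [hnm, hn, hne, hb, ht]
    have hbm : b • m ∈ S := hS _ (by rw [mink_smul_self, hm, mul_zero]) (by simp [hnm, hb, ht])
    have h1 := S.sub_mem (hmem 1 (by ring)) hbm
    have h2 := S.sub_mem (hmem (-1) (by ring)) hbm
    have h3 := S.add_mem h1 h2
    convert h3 using 1
    module
  have hgen : ∀ x, mink n x ≠ 0 → x ∈ S := by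
    intro x hx
    rw [← sub_add_cancel x ((mink x x / (2 * mink n x)) • n)]
    refine S.add_mem (hS _ ?_ ?_) (hline _)
    · rw [mink_sub_self, mink_smul_self, map_smul, hn, mink_comm x n, smul_eq_mul]
      field_simp; ring
    · simpa [hn] using hx
  have hx : x ∈ S := by
    by_cases h : mink n x = 0
    · rw [← add_sub_cancel_right x m]
      exact S.sub_mem (hgen _ (by rw [map_add, h, hnm, zero_add]; exact ht))
        (hgen _ (by rw [hnm]; exact ht))
    · exact hgen x h
  exact hx p

/-- A bijection preserving lightlike separation is additive up to a translation. -/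
theorem map_add_sub (hd : 3 ≤ d) (x y : Coord Q d) : f (x + y) - f x = f y - f 0 := by
  obtain ⟨n, n', hn, hn', rfl⟩ := exists_null_add_null hd y
  have h1 := hf.map_add_null_sub hd hn' 0 (x + n)
  have h2 := hf.map_add_null_sub hd hn 0 x
  have h3 := hf.map_add_null_sub hd hn' 0 n
  simp only [zero_add] at h1 h2 h3
  rw [← add_assoc, ← sub_add_sub_cancel _ (f (x + n)), h1, h2, ← h3]
  abel

end NullPreserving

end NullPreserving

/-! ### Additive null-preserving bijections are semilinear similarities. -/

section AdditiveNullPreserving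

variable {Q : Type*} [Field Q] [LinearOrder Q] [IsStrictOrderedRing Q] {d : ℕ} [NeZero d]
  {g : Coord Q d ≃+ Coord Q d}

namespace NullPreserving

variable (hg : NullPreserving g.toEquiv)
include hg

omit [LinearOrder Q] [IsStrictOrderedRing Q] in
theorem null_iff (x : Coord Q d) : mink x x = 0 ↔ mink (g x) (g x) = 0 := by
  simpa using hg x 0

theorem map_smul_null {n : Coord Q d} (hn : mink n n = 0) (hn0 : n ≠ 0) (c : Q) :
    ∃ c' : Q, g (c • n) = c' • g n := by
  simpa using hg.map_line hn hn0 0 c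

omit [LinearOrder Q] [IsStrictOrderedRing Q] in
theorem map_unitTime_ne : mink (g unitTime) (g unitTime) ≠ 0 := by
  rw [Ne, ← hg.null_iff, mink_unitTime]; exact one_ne_zero

omit [LinearOrder Q] [IsStrictOrderedRing Q] hg in
theorem _root_.Kinematics.mink_unitTime_single {i : Fin d} (hi : i ≠ 0) (c : Q) :
    mink (unitTime : Coord Q d) (Pi.single i c) = 0 := by
  rw [mink_unitTime_left]; simp [hi.symm]

omit [LinearOrder Q] [IsStrictOrderedRing Q] hg in
theorem _root_.Kinematics.mink_single_self {i : Fin d} (hi : i ≠ 0) (c : Q) :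
    mink (Pi.single i c : Coord Q d) (Pi.single i c) = - c ^ 2 := by
  rw [mink_single_right hi]; simp [sq]

/-- Add and subtract the null conditions for the images of the time unit plus and minus a spatial
unit. -/
theorem map_single_orthogonal {i : Fin d} (hi : i ≠ 0) :
    mink (g unitTime) (g (Pi.single i 1)) = 0 ∧
      mink (g (Pi.single i 1)) (g (Pi.single i 1)) = - mink (g unitTime) (g unitTime) := by
  have h1 : mink (g (unitTime + Pi.single i 1)) (g (unitTime + Pi.single i 1)) = 0 := by
    rw [← hg.null_iff, mink_add_self, mink_unitTime, mink_unitTime_single hi, mink_single_self hi]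
    ring
  have h2 : mink (g (unitTime - Pi.single i 1)) (g (unitTime - Pi.single i 1)) = 0 := by
    rw [← hg.null_iff, mink_sub_self, mink_unitTime, mink_unitTime_single hi, mink_single_self hi]
    ring
  rw [map_add, mink_add_self] at h1
  rw [map_sub, mink_sub_self] at h2
  constructor <;> linarith

theorem map_single_single {i j : Fin d} (hi : i ≠ 0) (hj : j ≠ 0) (hij : i ≠ j) :
    mink (g (Pi.single i 1)) (g (Pi.single j 1)) = 0 := by
  -- Since `g` is only known to be additive, the null vector must have integer coefficients: `5² =
  -- 3² + 4²`.
  have h : mink (g (5 • unitTime + (3 • Pi.single i 1 + 4 • Pi.single j 1)))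
      (g (5 • unitTime + (3 • Pi.single i 1 + 4 • Pi.single j 1))) = 0 := by
    rw [← hg.null_iff, mink_add_self, mink_add_self]
    simp only [map_nsmul, map_add, LinearMap.smul_apply, mink_unitTime, mink_unitTime_single hi,
      mink_unitTime_single hj, mink_single_self hi, mink_single_self hj, mink_single_right hj,
      Pi.single_eq_of_ne hij.symm]
    norm_num
  obtain ⟨h1, h2⟩ := hg.map_single_orthogonal hi
  obtain ⟨h3, h4⟩ := hg.map_single_orthogonal hj
  rw [map_add g, map_add g, mink_add_self, mink_add_self] at h
  simp only [map_nsmul, map_add, LinearMap.smul_apply, h1, h2, h3, h4] at h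
  simp only [nsmul_eq_mul] at h
  push_cast at h
  linarith

/-- Each of four null vectors is scaled by some factor. The two resulting expressions for twice the
image of `c • unitTime`, compared along the orthogonal images of the three axes, force the four
factors to agree. -/
theorem exists_map_smul_pair {i j : Fin d} (hi : i ≠ 0) (hj : j ≠ 0) (hij : i ≠ j) (c : Q) :
    ∃ a : Q, g (c • unitTime) = a • g unitTime ∧
      g (c • Pi.single i 1) = a • g (Pi.single i 1) ∧
      g (c • Pi.single j 1) = a • g (Pi.single j 1) := by
  have hadd : ∀ k : Fin d, k ≠ 0 → ∃ a : Q,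
      g (c • (unitTime + Pi.single k 1)) = a • g (unitTime + Pi.single k 1) := fun k hk => by
    refine hg.map_smul_null ?_ (fun h => ?_) c
    · rw [mink_add_self, mink_unitTime, mink_unitTime_single hk, mink_single_self hk]; ring
    · simpa [unitTime, hk.symm] using congrFun h 0
  have hsub : ∀ k : Fin d, k ≠ 0 → ∃ a : Q,
      g (c • (unitTime - Pi.single k 1)) = a • g (unitTime - Pi.single k 1) := fun k hk => by
    refine hg.map_smul_null ?_ (fun h => ?_) c
    · rw [mink_sub_self, mink_unitTime, mink_unitTime_single hk, mink_single_self hk]; ring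
    · simpa [unitTime, hk.symm] using congrFun h 0
  obtain ⟨a₁, h₁⟩ := hadd i hi
  obtain ⟨a₂, h₂⟩ := hsub i hi
  obtain ⟨a₃, h₃⟩ := hadd j hj
  obtain ⟨a₄, h₄⟩ := hsub j hj
  have hb := hg.map_unitTime_ne
  obtain ⟨o1, o2⟩ := hg.map_single_orthogonal hi
  obtain ⟨o3, o4⟩ := hg.map_single_orthogonal hj
  have o5 := hg.map_single_single hi hj hij
  rw [smul_add, map_add, map_add] at h₁ h₃
  rw [smul_sub, map_sub, map_sub] at h₂ h₄
  set T := g unitTime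
  set I := g (Pi.single i 1)
  set J := g (Pi.single j 1)
  have e : a₁ • (T + I) + a₂ • (T - I) = a₃ • (T + J) + a₄ • (T - J) := by
    rw [← h₁, ← h₂, ← h₃, ← h₄]; abel
  have eT := congrArg (mink T) e
  have eI := congrArg (mink I) e
  have eJ := congrArg (mink J) e
  simp only [map_add, map_sub, map_smul, o1, o2, o3, o4, o5, mink_comm I T, mink_comm J T,
    mink_comm J I, smul_eq_mul] at eT eI eJ
  have k1 : a₁ = a₂ := mul_right_cancel₀ hb (by linarith)
  have k2 : a₃ = a₄ := mul_right_cancel₀ hb (by linarith)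
  have k3 : a₁ = a₃ := mul_right_cancel₀ hb (by rw [← k1, ← k2] at eT; linarith)
  subst k1 k2 k3
  have double : ∀ x y : Coord Q d, x + x = y + y → x = y := fun x y h => funext fun l => by
    have := congrFun h l
    simp only [Pi.add_apply] at this
    linarith
  have hT : g (c • unitTime) = a₁ • T := by
    apply double
    calc _ = (g (c • unitTime) + g (c • Pi.single i 1)) +
          (g (c • unitTime) - g (c • Pi.single i 1)) := by abel
      _ = _ := by rw [h₁, h₂]; module
  refine ⟨a₁, hT, ?_, ?_⟩
  · rw [hT, smul_add] at h₁; exact add_left_cancel h₁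
  · rw [hT, smul_add] at h₃; exact add_left_cancel h₃

theorem exists_map_smul_single (hd : 3 ≤ d) (c : Q) :
    ∃ a : Q, ∀ i : Fin d, g (c • Pi.single i 1) = a • g (Pi.single i 1) := by
  let i : Fin d := ⟨1, by omega⟩
  let j : Fin d := ⟨2, by omega⟩
  have hi : i ≠ 0 := by simp [i, Fin.ext_iff]
  have hj : j ≠ 0 := by simp [j, Fin.ext_iff]
  have hij : i ≠ j := by simp [i, j, Fin.ext_iff]
  obtain ⟨a, h0, h1, -⟩ := hg.exists_map_smul_pair hi hj hij c
  refine ⟨a, fun k => ?_⟩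
  by_cases hk : k = 0
  · subst hk; exact h0
  by_cases hik : i = k
  · subst hik; exact h1
  obtain ⟨a', h0', -, h2⟩ := hg.exists_map_smul_pair hi hk hik c
  have hT : g unitTime ≠ 0 := fun h => hg.map_unitTime_ne (by rw [h]; simp)
  rwa [smul_left_injective Q hT (h0.symm.trans h0')]

/-- An additive bijection preserving null vectors is semilinear and multiplies the Minkowski form,
up to the same field endomorphism, by a nonzero constant. -/
theorem exists_ringHom (hd : 3 ≤ d) : ∃ φ : Q →+* Q,
    (∀ c x, g (c • x) = φ c • g x) ∧
      ∀ x, mink (g x) (g x) = φ (mink x x) * mink (g unitTime) (g unitTime) := by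
  choose φ hφ using hg.exists_map_smul_single hd
  have hb := hg.map_unitTime_ne
  have hT : g unitTime ≠ 0 := fun h => hb (by rw [h]; simp)
  have hφT : ∀ c, g (c • unitTime) = φ c • g unitTime := fun c => hφ c 0
  have inj : Function.Injective fun c : Q => c • g unitTime := smul_left_injective Q hT
  have hadd : ∀ a b, φ (a + b) = φ a + φ b := fun a b => inj <| by
    simp only; rw [← hφT, add_smul, add_smul, map_add, hφT, hφT]
  have hone : φ 1 = 1 := inj <| by simp only; rw [← hφT, one_smul, one_smul]
  have hzero : φ 0 = 0 := by simpa using hadd 0 0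
  have hsub : ∀ a b, φ (a - b) = φ a - φ b := fun a b => by
    rw [eq_sub_iff_add_eq, ← hadd, sub_add_cancel]
  -- The parametrized null vector from `(1 + t²)² = (1 - t²)² + (2t)²` gives compatibility with
  -- squares; multiplicativity follows by polarization.
  have hsq : ∀ t, φ (t ^ 2) = φ t ^ 2 := by
    intro t
    let i : Fin d := ⟨1, by omega⟩
    let j : Fin d := ⟨2, by omega⟩
    have hi : i ≠ 0 := by simp [i, Fin.ext_iff]
    have hj : j ≠ 0 := by simp [j, Fin.ext_iff]
    have hij : i ≠ j := by simp [i, j, Fin.ext_iff]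
    have h : mink (g ((1 + t ^ 2) • unitTime +
          ((1 - t ^ 2) • Pi.single i 1 + (t + t) • Pi.single j 1)))
        (g ((1 + t ^ 2) • unitTime +
          ((1 - t ^ 2) • Pi.single i 1 + (t + t) • Pi.single j 1))) = 0 := by
      rw [← hg.null_iff, mink_add_self, mink_add_self]
      simp only [map_smul, map_add, LinearMap.smul_apply, mink_unitTime, mink_unitTime_single hi,
        mink_unitTime_single hj, mink_single_self hi, mink_single_self hj, mink_single_right hj,
        Pi.single_eq_of_ne hij.symm, smul_eq_mul]
      ring
    obtain ⟨h1, h2⟩ := hg.map_single_orthogonal hi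
    obtain ⟨h3, h4⟩ := hg.map_single_orthogonal hj
    rw [map_add g, map_add g, hφT, hφ, hφ, mink_add_self, mink_add_self] at h
    simp only [map_smul, map_add, LinearMap.smul_apply, h1, h2, h3, h4,
      hg.map_single_single hi hj hij, smul_eq_mul, hadd, hsub, hone] at h
    refine mul_right_cancel₀ hb ?_
    linear_combination h / 4
  have hmul : ∀ a b, φ (a * b) = φ a * φ b := by
    intro a b
    have h1 := hsq (a + b)
    rw [hadd a b, show (a + b) ^ 2 = a ^ 2 + b ^ 2 + (a * b + a * b) by ring, hadd, hadd, hadd,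
      hsq, hsq] at h1
    linear_combination h1 / 2
  have hsum : ∀ x, g x = ∑ i, φ (x i) • g (Pi.single i 1) := by
    intro x
    conv_lhs => rw [pi_eq_sum_univ' x]
    rw [map_sum]
    exact Finset.sum_congr rfl fun i _ => by rw [← hφ]
  refine ⟨⟨⟨⟨φ, hone⟩, hmul⟩, hzero, hadd⟩, fun c x => ?_, fun x => ?_⟩
  · rw [hsum, hsum x]
    simp [hmul, mul_smul, Finset.smul_sum]
  · change _ = φ (mink x x) * _
    have hφsum : ∀ F : {i : Fin d // i ≠ 0} → Q, φ (∑ i, F i) = ∑ i, φ (F i) :=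
      fun F => map_sum (⟨⟨φ, hzero⟩, hadd⟩ : Q →+ Q) F _
    have hoff : ∀ i j : Fin d, i ≠ j → mink (g (Pi.single i 1)) (g (Pi.single j 1)) = 0 := by
      intro i j hij
      by_cases hi : i = 0
      · subst hi; exact (hg.map_single_orthogonal hij.symm).1
      by_cases hj : j = 0
      · subst hj; rw [mink_comm]; exact (hg.map_single_orthogonal hi).1
      exact hg.map_single_single hi hj hij
    have hdiag : mink (g x) (g x) =
        ∑ i, φ (x i) ^ 2 * mink (g (Pi.single i 1)) (g (Pi.single i 1)) := by
      conv_lhs => rw [hsum x]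
      rw [map_sum]
      refine Finset.sum_congr rfl fun i _ => ?_
      rw [mink_comm, map_sum, Finset.sum_eq_single i]
      · simp only [map_smul, LinearMap.smul_apply, smul_eq_mul]; ring
      · intro j _ hj
        simp only [map_smul, LinearMap.smul_apply, hoff i j hj.symm, smul_zero]
      · simp
    rw [hdiag, Fintype.sum_eq_add_sum_subtype_ne _ 0, mink_apply x x, hsub, hφsum, hmul, sub_mul,
      Finset.sum_mul, sub_eq_add_neg, ← Finset.sum_neg_distrib, sq]
    congr 1
    refine Finset.sum_congr rfl fun i _ => ?_
    rw [(hg.map_single_orthogonal i.2).2, hmul]; ring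

/-- If moreover lengths of vectors that are spatial on both sides are preserved, then the map is a
linear Lorentz transformation. -/
theorem linear_and_mink_eq (hd : 3 ≤ d)
    (hsym : ∀ x : Coord Q d, x 0 = 0 → g x 0 = 0 → mink (g x) (g x) = mink x x) :
    (∀ (c : Q) x, g (c • x) = c • g x) ∧ ∀ x, mink (g x) (g x) = mink x x := by
  obtain ⟨φ, hs, hq⟩ := hg.exists_ringHom hd
  have hpolar : ∀ x y, mink (g x) (g y) = φ (mink x y) * mink (g unitTime) (g unitTime) := by
    intro x y
    have h := hq (x + y)
    rw [map_add, mink_add_self, mink_add_self, map_add, map_add, map_mul, hq x, hq y,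
      map_ofNat] at h
    linear_combination h / 2
  -- Orthogonality to the preimage of the time unit makes `g e` spatial too. All multiples of `e`
  -- then keep their length, so `φ c ^ 2 = c ^ 2`; comparing `c + 1` with `c` gives `φ c = c`.
  obtain ⟨e, he0, hne, hee⟩ := exists_spatial_orthogonal hd (g.symm unitTime)
  have hge0 : g e 0 = 0 := by
    have := hpolar (g.symm unitTime) e
    rwa [hne, map_zero, zero_mul, g.apply_symm_apply, mink_unitTime_left] at this
  have hge := hsym e he0 hge0
  have hφsq : ∀ c, φ c ^ 2 = c ^ 2 := by
    intro c
    have h := hsym (c • e) (by simp [he0]) (by simp [hs, hge0])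
    rw [hs, mink_smul_self, mink_smul_self, hge] at h
    exact mul_right_cancel₀ hee h
  have hφ : ∀ c, φ c = c := by
    intro c
    have h := hφsq (c + 1)
    rw [map_add, map_one] at h
    linear_combination (h - hφsq c) / 2
  have hb : mink (g unitTime) (g unitTime) = 1 := by
    have := hq e
    rw [hge, hφ] at this
    exact (mul_eq_left₀ hee).1 this.symm
  exact ⟨fun c x => by rw [hs, hφ], fun x => by rw [hq, hφ, hb, mul_one]⟩

end NullPreserving

/-- A bijection that preserves lightlike separation, as well as the distance of points that are
simultaneous on both sides, is an affine isometry of the Minkowski form. -/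
theorem NullPreserving.affine_isometry (hd : 3 ≤ d) {f : Coord Q d ≃ Coord Q d}
    (hf : NullPreserving f)
    (hsym : ∀ p q : Coord Q d, p 0 = q 0 → f p 0 = f q 0 →
      mink (f p - f q) (f p - f q) = mink (p - q) (p - q)) :
    (∀ (c : Q) p q, f (p + c • (q - p)) = f p + c • (f q - f p)) ∧
      ∀ p q, mink (f p - f q) (f p - f q) = mink (p - q) (p - q) := by
  let g : Coord Q d ≃+ Coord Q d :=
    { toEquiv := f.trans (Equiv.subRight (f 0))
      map_add' := fun x y => by
        have := hf.map_add_sub hd x y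
        simp only [Equiv.toFun_as_coe, Equiv.trans_apply, Equiv.subRight_apply]
        rw [← this]; abel }
  have hgf : ∀ x, g x = f x - f 0 := fun x => rfl
  have hg : NullPreserving g.toEquiv := fun p q => by
    change _ ↔ mink (g p - g q) (g p - g q) = 0
    rw [hgf, hgf, sub_sub_sub_cancel_right]; exact hf p q
  have hsub : ∀ p q, f p - f q = g (p - q) := fun p q => by rw [map_sub, hgf, hgf]; abel
  obtain ⟨hl, hm⟩ := hg.linear_and_mink_eq hd fun x hx hgx => by
    have := hsym x 0 (by simpa using hx) (by
      rw [hgf, Pi.sub_apply, sub_eq_zero] at hgx; exact hgx)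
    simpa [hsub] using this
  exact ⟨fun c p q => by rw [hsub, ← hl, ← sub_eq_iff_eq_add', hsub]; simp,
    fun p q => by rw [hsub, hm]⟩

end AdditiveNullPreserving

/-! ### The clock paradox from the symmetric distance axiom. -/

namespace Model

variable {d : ℕ} [NeZero d] {Q : Type u} [Field Q] [LinearOrder Q] [IsEuclideanOrderedField Q]
  {B : Type v} {M : Model d Q B}

theorem AxPh.null_iff (h : M.AxPh) {m : B} (hm : m ∈ M.IOb) (p q : Coord Q d) :
    mink (p - q) (p - q) = 0 ↔ (M.Ph ∩ M.ev m p ∩ M.ev m q).Nonempty := by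
  rw [← length_eq_iff_null, h m hm]

theorem AxPh.ev_nonempty (h : M.AxPh) {m : B} (hm : m ∈ M.IOb) (p : Coord Q d) :
    (M.ev m p).Nonempty := by
  obtain ⟨b, hb⟩ := (h.null_iff hm p p).1 (by simp)
  exact ⟨b, hb.2⟩

theorem AxPh.ev_injective (h : M.AxPh) {m : B} (hm : m ∈ M.IOb) :
    Function.Injective (M.ev m) := fun p q hpq => eq_of_null_iff fun r => by
  rw [h.null_iff hm, h.null_iff hm, hpq]

/-- The worldview transformation is a bijection that preserves lightlike separation. -/
theorem SpecRel₀.exists_worldview (h : M.SpecRel₀) {k m : B} (hk : k ∈ M.IOb) (hm : m ∈ M.IOb) :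
    ∃ f : Coord Q d ≃ Coord Q d, NullPreserving f ∧ ∀ p, M.ev m (f p) = M.ev k p := by
  obtain ⟨-, hph, hev⟩ := h
  have hex : ∀ k ∈ M.IOb, ∀ m ∈ M.IOb, ∀ p, ∃ q, M.ev m q = M.ev k p := fun k hk m hm p => by
    have hp : M.ev k p ∈ M.Ev k := ⟨hph.ev_nonempty hk p, p, rfl⟩
    rw [hev k hk m hm] at hp
    exact hp.2
  choose f hf using hex k hk m hm
  choose f' hf' using hex m hm k hk
  refine ⟨⟨f, f', fun p => hph.ev_injective hk (by rw [hf', hf]),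
    fun p => hph.ev_injective hm (by rw [hf, hf'])⟩, fun p q => ?_, hf⟩
  rw [hph.null_iff hk, hph.null_iff hm]
  simp only [Equiv.coe_fn_mk, hf]

theorem AxPh.loc_ev (h : M.AxPh) {m : B} (hm : m ∈ M.IOb) (p : Coord Q d) :
    M.loc m (M.ev m p) p :=
  ⟨rfl, fun _ hq => h.ev_injective hm hq⟩

/-- With the symmetric distance axiom the worldview transformation is a Poincaré transformation. -/
theorem SpecRel₀.exists_isometry (hd : 3 ≤ d) (h : M.SpecRel₀) (hsym : M.AxSymDist)
    {k m : B} (hk : k ∈ M.IOb) (hm : m ∈ M.IOb) :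
    ∃ f : Coord Q d ≃ Coord Q d, (∀ p, M.ev m (f p) = M.ev k p) ∧
      (∀ (c : Q) p q, f (p + c • (q - p)) = f p + c • (f q - f p)) ∧
      ∀ p q, mink (f p - f q) (f p - f q) = mink (p - q) (p - q) := by
  obtain ⟨f, hf, hev⟩ := h.exists_worldview hk hm
  refine ⟨f, hev, hf.affine_isometry hd fun p q hpq hfpq => ?_⟩
  have hph := h.2.1
  have hmem : ∀ p, M.ev k p ∈ M.Ev m ∩ M.Ev k := fun p =>
    ⟨⟨hph.ev_nonempty hk p, f p, hev p⟩, ⟨hph.ev_nonempty hk p, p, rfl⟩⟩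
  obtain ⟨x, ⟨p₁, q₁, hp₁, hq₁, hx₁⟩, ⟨p₂, q₂, hp₂, hq₂, hx₂⟩⟩ :=
    hsym m hm k hk _ (hmem p) _ (hmem q) ⟨f p, f q, hev p, hev q, hfpq⟩ ⟨p, q, rfl, rfl, hpq⟩
  obtain rfl := hp₁.2 _ (hev p)
  obtain rfl := hq₁.2 _ (hev q)
  obtain rfl := hp₂.2 _ rfl
  obtain rfl := hq₂.2 _ rfl
  rw [hx₁, length_spaceComp_eq hfpq, length_spaceComp_eq hpq, sqrt_inj, neg_inj] at hx₂
  · exact hx₂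
  · exact neg_nonneg.2 (mink_self_nonpos (sub_eq_zero.2 hfpq))
  · exact neg_nonneg.2 (mink_self_nonpos (sub_eq_zero.2 hpq))

/-- Clocks measure the Minkowski length of the segment they travel along. -/
theorem SpecRel₀.elapsedTime (hd : 3 ≤ d) (h : M.SpecRel₀) (hsym : M.AxSymDist)
    {k m : B} (hk : k ∈ M.IOb) (hm : m ∈ M.IOb) {A E : Coord Q d} (hA : k ∈ M.ev m A)
    (hE : k ∈ M.ev m E) (hAE : A ≠ E) :
    0 < mink (E - A) (E - A) ∧
      M.elapsedTime k (M.ev m A) (M.ev m E) (sqrt (mink (E - A) (E - A))) ∧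
      ∀ t : Q, k ∈ M.ev m (A + t • (E - A)) := by
  obtain ⟨f, hev, haff, hiso⟩ := h.exists_isometry hd hsym hk hm
  have hself := h.1 k (M.IOb_subset_Ob hk)
  obtain ⟨p, rfl⟩ := f.surjective A
  obtain ⟨q, rfl⟩ := f.surjective E
  rw [hev, hself] at hA hE
  -- In its own coordinates `k` stays on the time axis, where the form is the squared time
  -- difference.
  have hmink : mink (f q - f p) (f q - f p) = (timeComp p - timeComp q) ^ 2 := by
    rw [mink_sub_self_comm, hiso, mink_self_of_spaceComp_eq (hA.2.trans hE.2.symm)]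
  rw [hmink, hev, hev]
  refine ⟨?_, ⟨p, q, h.2.1.loc_ev hk p, h.2.1.loc_ev hk q, sqrt_sq⟩, fun t => ?_⟩
  · refine sq_pos_of_ne_zero fun h0 => hAE (congrArg f (funext fun i => ?_))
    by_cases hi : i = 0
    · subst hi; exact sub_eq_zero.1 h0
    · exact congrFun (hA.2.trans hE.2.symm) ⟨i, hi⟩
  · rw [← haff, hev, hself]
    refine ⟨h.2.1.ev_nonempty hk _, funext fun i => ?_⟩
    have h1 : p i = 0 := congrFun hA.2 i
    have h2 : q i = 0 := congrFun hE.2 i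
    simp [spaceComp, h1, h2]

/-- The symmetric distance axiom implies the clock paradox. -/
theorem SpecRel₀.cp (hd : 3 ≤ d) (h : M.SpecRel₀) (hsym : M.AxSymDist) : M.CP := by
  rintro m hm a ha b hb c hc ea - e - ec - ⟨ha', hb', hc', hbe, htime⟩
  -- Both temporal orders are captured by one condition: the time components of the two legs have
  -- the same sign.
  obtain ⟨A, E, C, rfl, rfl, rfl, hAE, hEC, hpos⟩ : ∃ A E C, M.ev m A = ea ∧ M.ev m E = e ∧
      M.ev m C = ec ∧ A ≠ E ∧ E ≠ C ∧ 0 < (E - A) 0 * (C - E) 0 := by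
    rcases htime with ⟨⟨A, E, hA, hE, h₁⟩, ⟨E', C, hE', hC, h₂⟩⟩ |
      ⟨⟨E, A, hE, hA, h₁⟩, ⟨C, E', hC, hE', h₂⟩⟩ <;>
    obtain rfl := hE.2 _ hE'.1
    · refine ⟨A, E', C, hA.1, hE.1, hC.1, ?_, ?_, mul_pos (sub_pos.2 h₁) (sub_pos.2 h₂)⟩
      · rintro rfl; exact h₁.false
      · rintro rfl; exact h₂.false
    · refine ⟨A, E', C, hA.1, hE.1, hC.1, ?_, ?_,
        mul_pos_of_neg_of_neg (sub_neg.2 h₁) (sub_neg.2 h₂)⟩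
      · rintro rfl; exact h₁.false
      · rintro rfl; exact h₂.false
  obtain ⟨h₁, t₁, -⟩ := h.elapsedTime hd hsym ha hm ha'.1 ha'.2 hAE
  obtain ⟨h₂, t₂, -⟩ := h.elapsedTime hd hsym hc hm hc'.1 hc'.2 hEC
  have ho := (mink_pos_iff h₁ h₂).2 hpos
  have hAC : A ≠ C := by
    rintro rfl
    rw [← neg_sub, Pi.neg_apply] at hpos
    nlinarith [sq_nonneg ((A - E) 0)]
  obtain ⟨-, t₃, hline⟩ := h.elapsedTime hd hsym hb hm hb'.1 hb'.2 hAC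
  refine ⟨_, _, _, t₁, t₂, t₃, sqrt_mink_add_lt_of_avoid h₁ h₂ ho fun t ht => hbe ?_⟩
  rw [ht]; exact hline t

end Model

/-! ### Frames normalized by a non-invariant clock, and photons. -/

section Frames

/-- A coordinate frame: a similarity of the Minkowski form followed by a translation, with the
time unit normalized in such a way that `sqrt (mink x x) + |x 0| = 1` holds for it. -/
structure Frame (Q : Type u) [Field Q] [LinearOrder Q] (d : ℕ) [NeZero d] where
  origin : Coord Q d
  linear : Coord Q d ≃ₗ[Q] Coord Q d
  pos : 0 < mink (linear unitTime) (linear unitTime)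
  mink_linear : ∀ x, mink (linear x) (linear x) =
    mink x x * mink (linear unitTime) (linear unitTime)
  normalized : sqrt (mink (linear unitTime) (linear unitTime)) + |linear unitTime 0| = 1

/-- A photon trajectory: a point and a lightlike direction. -/
structure Ray (Q : Type u) [Field Q] (d : ℕ) [NeZero d] where
  origin : Coord Q d
  direction : Coord Q d
  null : mink direction direction = 0
  ne_zero : direction ≠ 0

variable {Q : Type u} [Field Q] [LinearOrder Q] {d : ℕ} [NeZero d]

/-- The time measured along the vector `x` by clocks of frames. -/
noncomputable def properTime (x : Coord Q d) : Q := sqrt (mink x x) + |x 0|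

namespace Frame

/-- The affine map from the coordinates of a frame to the reference coordinates. -/
def toEquiv (F : Frame Q d) : Coord Q d ≃ Coord Q d :=
  F.linear.toEquiv.trans (Equiv.addLeft F.origin)

theorem toEquiv_apply (F : Frame Q d) (p : Coord Q d) :
    F.toEquiv p = F.origin + F.linear p := rfl

theorem toEquiv_add (F : Frame Q d) (p x : Coord Q d) :
    F.toEquiv (p + x) = F.toEquiv p + F.linear x := by
  rw [toEquiv_apply, toEquiv_apply, map_add, add_assoc]

theorem toEquiv_sub (F : Frame Q d) (p q : Coord Q d) :
    F.toEquiv p - F.toEquiv q = F.linear (p - q) := by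
  rw [toEquiv_apply, toEquiv_apply, map_sub]; abel

theorem symm_toEquiv_sub (F : Frame Q d) (p q : Coord Q d) :
    F.toEquiv.symm p - F.toEquiv.symm q = F.linear.symm (p - q) := by
  rw [LinearEquiv.eq_symm_apply, ← toEquiv_sub, Equiv.apply_symm_apply, Equiv.apply_symm_apply]

instance [Small.{v} Q] : Small.{v} (Frame Q d) :=
  small_of_injective (β := Coord Q d × (Coord Q d → Coord Q d))
    (f := fun F => (F.origin, F.linear)) fun F G h => by
      cases F; cases G
      simpa using h

end Frame

instance [Small.{v} Q] : Small.{v} (Ray Q d) :=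
  small_of_injective (β := Coord Q d × Coord Q d)
    (f := fun r => (r.origin, r.direction)) fun r s h => by
      cases r; cases s
      simpa using h

/-- The points on the world-line of a body. -/
def trajectory : Frame Q d ⊕ Ray Q d → Set (Coord Q d)
  | .inl F => {x | ∃ t : Q, x = F.toEquiv (t • unitTime)}
  | .inr r => {x | ∃ t : Q, x = r.origin + t • r.direction}

/-- The model whose bodies are the given frames and rays. -/
def frameModel {B : Type v} (φ : B ≃ Frame Q d ⊕ Ray Q d) : Model d Q B where
  Ob := {b | ∃ F, φ b = .inl F}
  IOb := {b | ∃ F, φ b = .inl F}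
  Ph := {b | ∃ r, φ b = .inr r}
  W m b p := ∃ F, φ m = .inl F ∧ F.toEquiv p ∈ trajectory (φ b)
  IOb_subset_Ob := subset_rfl
  W_observer := fun _ _ _ ⟨F, h, _⟩ => ⟨F, h⟩

variable [IsEuclideanOrderedField Q]

theorem properTime_smul (c : Q) {x : Coord Q d} (hx : 0 ≤ mink x x) :
    properTime (c • x) = |c| * properTime x := by
  have h : sqrt (mink (c • x) (c • x)) = |c| * sqrt (mink x x) := by
    rw [mink_smul_self, sqrt_eq_iff (mul_nonneg (sq_nonneg c) hx)
      (mul_nonneg (abs_nonneg c) (sqrt_nonneg hx)), mul_pow, sq_abs, sq_sqrt hx]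
  rw [properTime, properTime, h, Pi.smul_apply, smul_eq_mul, abs_mul, mul_add]

theorem properTime_pos {x : Coord Q d} (hx : 0 < mink x x) : 0 < properTime x :=
  add_pos_of_pos_of_nonneg (sqrt_pos hx) (abs_nonneg _)

/-- Each timelike vector is the image of the time unit under a similarity. -/
theorem exists_similarity {v : Coord Q d} (hv : 0 < mink v v) :
    ∃ L : Coord Q d ≃ₗ[Q] Coord Q d, L unitTime = v ∧
      ∀ x, mink (L x) (L x) = mink x x * mink v v := by
  -- The sign of `s` opposite to `v 0` makes `w = v - s • unitTime` non-null, so the reflection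
  -- along `w` exists; it carries `s • unitTime` to `v`.
  obtain ⟨s, hs, hsv⟩ : ∃ s : Q, s ^ 2 = mink v v ∧ s * v 0 < 0 := by
    have h := sq_sqrt hv.le
    have hp := sqrt_pos hv
    rcases (time_ne_zero_of_pos hv).lt_or_gt with h0 | h0
    · exact ⟨_, h, mul_neg_of_pos_of_neg hp h0⟩
    · exact ⟨-sqrt (mink v v), by rw [neg_sq, h], mul_neg_of_neg_of_pos (by linarith) h0⟩
  have hs0 : s ≠ 0 := by rintro rfl; simp at hsv
  let w := v - s • unitTime
  have hw : mink w w = 2 * (s ^ 2 - s * v 0) := by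
    rw [mink_sub_self, mink_smul_self, mink_unitTime, map_smul, mink_comm v unitTime,
      mink_unitTime_left, smul_eq_mul, hs]
    ring
  have hw0 : mink w w ≠ 0 := by
    rw [hw]
    have := sq_nonneg s
    exact (by linarith : 0 < 2 * (s ^ 2 - s * v 0)).ne'
  have href : ((2 / mink w w) • mink w) w = 2 := by
    rw [LinearMap.smul_apply, smul_eq_mul, div_mul_cancel₀ _ hw0]
  refine ⟨(LinearEquiv.smulOfNeZero Q (Coord Q d) s hs0).trans (Module.reflection href), ?_, ?_⟩
  · have hwu : mink w unitTime = v 0 - s := by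
      rw [mink_comm, mink_unitTime_left]; simp [w, unitTime]
    rw [LinearEquiv.trans_apply, LinearEquiv.smulOfNeZero_apply, Module.reflection_apply,
      LinearMap.smul_apply, map_smul, hwu]
    have : (2 / mink w w) • s • (v 0 - s) = -1 := by
      rw [hw] at hw0 ⊢
      simp only [smul_eq_mul]
      field_simp at hw0 ⊢
      have : s - v 0 ≠ 0 := fun h => by simp [h] at hw0
      field_simp
      ring
    rw [this]
    simp [w]
  · intro x
    rw [LinearEquiv.trans_apply, LinearEquiv.smulOfNeZero_apply, Module.reflection_apply,
      LinearMap.smul_apply, mink_sub_self, mink_smul_self, mink_smul_self, ← hs]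
    simp only [map_smul, LinearMap.smul_apply, smul_eq_mul, mink_comm x w]
    field_simp
    ring

/-- There is a frame with a given origin and direction of the time axis. -/
theorem Frame.exists_of_timelike (o : Coord Q d) {v : Coord Q d} (hv : 0 < mink v v) :
    ∃ F : Frame Q d, F.origin = o ∧ F.linear unitTime = (properTime v)⁻¹ • v := by
  have hp := properTime_pos hv
  have hpos : 0 < mink ((properTime v)⁻¹ • v) ((properTime v)⁻¹ • v) := by
    rw [mink_smul_self]; positivity
  obtain ⟨L, hL, hL'⟩ := exists_similarity hpos
  refine ⟨⟨o, L, by rwa [hL], by rwa [hL], ?_⟩, rfl, hL⟩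
  rw [hL]
  change properTime _ = 1
  rw [properTime_smul _ hv.le, abs_of_pos (inv_pos.2 hp), inv_mul_cancel₀ hp.ne']

theorem Frame.mink_linear_linear (F : Frame Q d) (x y : Coord Q d) :
    mink (F.linear x) (F.linear y) =
      mink x y * mink (F.linear unitTime) (F.linear unitTime) := by
  have h := F.mink_linear (x + y)
  rw [map_add, mink_add_self, mink_add_self, F.mink_linear, F.mink_linear y] at h
  linear_combination h / 2

theorem exists_null_ne_zero (hd : 3 ≤ d) : ∃ n : Coord Q d, mink n n = 0 ∧ n ≠ 0 := by
  have hi : (⟨1, by omega⟩ : Fin d) ≠ 0 := by simp [Fin.ext_iff]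
  refine ⟨unitTime + Pi.single ⟨1, by omega⟩ 1, ?_, fun h => ?_⟩
  · rw [mink_add_self, mink_unitTime, mink_unitTime_single hi, mink_single_self hi]; ring
  · simpa [unitTime, hi.symm] using congrFun h 0

/-! ### The model of all frames and rays satisfies everything but `AxSymDist`. -/

namespace frameModel

variable {B : Type v} (φ : B ≃ Frame Q d ⊕ Ray Q d)

/-- The set of bodies at a point of the reference coordinate system. -/
def event (x : Coord Q d) : Set B := {b | x ∈ trajectory (φ b)}

variable {φ}

omit [IsEuclideanOrderedField Q] in
theorem ev_eq {m : B} {F : Frame Q d} (hm : φ m = .inl F) (p : Coord Q d) :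
    (frameModel φ).ev m p = event φ (F.toEquiv p) := by
  ext b
  constructor
  · rintro ⟨F', hF', h⟩
    obtain rfl := Sum.inl_injective (hm.symm.trans hF')
    exact h
  · exact fun h => ⟨F, hm, h⟩

omit [IsEuclideanOrderedField Q] in
theorem mem_event {b : B} {F : Frame Q d} (hb : φ b = .inl F) {x : Coord Q d} :
    b ∈ event φ x ↔ ∃ t : Q, x = F.toEquiv (t • unitTime) := by
  change x ∈ trajectory (φ b) ↔ _
  rw [hb]; rfl

/-- The photon axiom in reference coordinates; frames inherit it because similarities preserve null
vectors. -/
theorem null_iff (hd : 3 ≤ d) (x y : Coord Q d) :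
    mink (x - y) (x - y) = 0 ↔ ((frameModel φ).Ph ∩ event φ x ∩ event φ y).Nonempty := by
  constructor
  · intro h
    by_cases hxy : x = y
    · subst hxy
      obtain ⟨n, hn, hn0⟩ := exists_null_ne_zero (Q := Q) hd
      have hx : φ.symm (.inr ⟨x, n, hn, hn0⟩) ∈ event φ x := by
        change x ∈ trajectory (φ _)
        rw [φ.apply_symm_apply]
        exact ⟨0, by simp⟩
      exact ⟨_, ⟨⟨_, φ.apply_symm_apply _⟩, hx⟩, hx⟩
    · refine ⟨φ.symm (.inr ⟨y, x - y, h, sub_ne_zero.2 hxy⟩), ⟨⟨_, φ.apply_symm_apply _⟩, ?_⟩, ?_⟩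
      · change x ∈ trajectory (φ _)
        rw [φ.apply_symm_apply]
        exact ⟨1, by simp⟩
      · change y ∈ trajectory (φ _)
        rw [φ.apply_symm_apply]
        exact ⟨0, by simp⟩
  · rintro ⟨b, ⟨⟨r, hr⟩, hx⟩, hy⟩
    change x ∈ trajectory (φ b) at hx
    change y ∈ trajectory (φ b) at hy
    rw [hr] at hx hy
    obtain ⟨s, rfl⟩ := hx
    obtain ⟨t, rfl⟩ := hy
    rw [add_sub_add_left_eq_sub, ← sub_smul, mink_smul_self, r.null, mul_zero]

theorem event_nonempty (hd : 3 ≤ d) (x : Coord Q d) : (event φ x).Nonempty := by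
  obtain ⟨b, hb⟩ := (null_iff (φ := φ) hd x x).1 (by simp)
  exact ⟨b, hb.2⟩

theorem event_injective (hd : 3 ≤ d) : Function.Injective (event φ) := fun x y hxy =>
  eq_of_null_iff fun r => by rw [null_iff (φ := φ) hd, null_iff (φ := φ) hd, hxy]

theorem loc_iff (hd : 3 ≤ d) {m : B} {F : Frame Q d} (hm : φ m = .inl F) (x p : Coord Q d) :
    (frameModel φ).loc m (event φ x) p ↔ p = F.toEquiv.symm x := by
  have h : ∀ q, (frameModel φ).ev m q = event φ x ↔ q = F.toEquiv.symm x := fun q => by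
    rw [ev_eq hm, (event_injective hd).eq_iff, Equiv.eq_symm_apply]
  simp only [Model.loc, h]
  exact ⟨fun h => h.1, fun h => ⟨h, fun q hq => hq.trans h.symm⟩⟩

theorem wValue (hd : 3 ≤ d) {k m : B} {F G : Frame Q d} (hk : φ k = .inl G) (hm : φ m = .inl F)
    (p : Coord Q d) : (frameModel φ).wValue k m p (F.toEquiv.symm (G.toEquiv p)) := by
  have h : ∀ q, (frameModel φ).w k m p q ↔ q = F.toEquiv.symm (G.toEquiv p) := fun q => by
    rw [Model.w, ev_eq hm, ev_eq hk, (event_injective hd).eq_iff, Equiv.eq_symm_apply, eq_comm]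
    exact and_iff_left (event_nonempty hd _)
  exact ⟨(h _).2 rfl, fun q hq => (h q).1 hq⟩

theorem timeUnitVector (hd : 3 ≤ d) {k m : B} {F G : Frame Q d} (hk : φ k = .inl G)
    (hm : φ m = .inl F) :
    (frameModel φ).timeUnitVector k m (F.linear.symm (G.linear unitTime)) := by
  refine ⟨_, _, wValue hd hk hm 0, wValue hd hk hm unitTime, ?_⟩
  rw [Frame.symm_toEquiv_sub, Frame.toEquiv_sub, sub_zero]

theorem axSelf₀ (hd : 3 ≤ d) : (frameModel φ).AxSelf₀ := by
  rintro m ⟨F, hm⟩ p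
  rw [ev_eq hm, mem_event hm, spaceComp_eq_zero_iff, Model.Cd, Set.mem_ofPred_eq, ev_eq hm]
  simp [event_nonempty hd]

theorem axPh (hd : 3 ≤ d) : (frameModel φ).AxPh := by
  rintro m ⟨F, hm⟩ p q
  rw [length_eq_iff_null, ev_eq hm, ev_eq hm, ← null_iff hd, Frame.toEquiv_sub, F.mink_linear,
    mul_eq_zero, or_iff_left F.pos.ne']

omit [IsEuclideanOrderedField Q] in
theorem mem_Ev {m : B} {F : Frame Q d} (hm : φ m = .inl F) (e : Set B) :
    e ∈ (frameModel φ).Ev m ↔ e.Nonempty ∧ ∃ x, event φ x = e := by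
  change (e.Nonempty ∧ ∃ p, (frameModel φ).ev m p = e) ↔ _
  simp only [ev_eq hm]
  exact and_congr_right' (F.toEquiv.surjective.exists (p := fun x => event φ x = e)).symm

omit [IsEuclideanOrderedField Q] in
theorem axEv : (frameModel φ).AxEv := by
  rintro m ⟨F, hm⟩ k ⟨G, hk⟩
  ext e
  rw [mem_Ev hm, mem_Ev hk]

theorem axLinTime (hd : 3 ≤ d) : (frameModel φ).AxLinTime := by
  rintro m ⟨F, hm⟩ k ⟨G, hk⟩
  have hF : ∀ c : Q, F.toEquiv (F.toEquiv.symm (G.toEquiv 0) +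
      c • F.linear.symm (G.linear unitTime)) = G.toEquiv (c • unitTime) := fun c => by
    rw [Frame.toEquiv_add, Equiv.apply_symm_apply, map_smul, LinearEquiv.apply_symm_apply,
      Frame.toEquiv_apply, Frame.toEquiv_apply, map_zero, add_zero, map_smul]
  have hwl : (frameModel φ).wl m k = {p | ∃ c : Q, p = F.toEquiv.symm (G.toEquiv 0) +
      c • F.linear.symm (G.linear unitTime)} := by
    ext p
    change k ∈ (frameModel φ).ev m p ↔ ∃ c : Q, p = _
    rw [ev_eq hm, mem_event hk]
    exact exists_congr fun c => by rw [← hF, F.toEquiv.injective.eq_iff]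
  refine ⟨_, _, wValue hd hk hm 0, timeUnitVector hd hk hm, hwl, ?_⟩
  rw [hwl]
  rintro _ ⟨s, rfl⟩ _ ⟨t, rfl⟩
  rw [ev_eq hm, ev_eq hm]
  refine ⟨|s - t|, ⟨s • unitTime, t • unitTime, ?_, ?_, ?_⟩, ?_⟩
  · rw [loc_iff hd hk, hF, Equiv.symm_apply_apply]
  · rw [loc_iff hd hk, hF, Equiv.symm_apply_apply]
  · simp [timeComp, unitTime]
  · rw [add_sub_add_left_eq_sub, ← sub_smul, length_smul]

theorem axShift (hd : 3 ≤ d) : (frameModel φ).AxShift := by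
  rintro m ⟨F, hm⟩ k ⟨G, hk⟩ p -
  -- The normalization involves only the linear part, so frames can be translated freely.
  let H : Frame Q d := { G with origin := F.toEquiv p }
  have hH : φ (φ.symm (.inl H)) = .inl H := φ.apply_symm_apply _
  refine ⟨φ.symm (.inl H), ⟨H, hH⟩, ?_, _, timeUnitVector hd hk hm,
    timeUnitVector (G := H) hd hH hm⟩
  rw [ev_eq hm, mem_event hH]
  exact ⟨0, by simp [Frame.toEquiv_apply, H]⟩

theorem axThExp : (frameModel φ).AxThExp := by
  rintro m ⟨F, hm⟩ p q hpq
  rw [length_lt_iff_timelike, mink_sub_self_comm] at hpq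
  have hv : 0 < mink (F.toEquiv q - F.toEquiv p) (F.toEquiv q - F.toEquiv p) := by
    rw [Frame.toEquiv_sub, F.mink_linear]; exact mul_pos hpq F.pos
  obtain ⟨H, ho, hl⟩ := Frame.exists_of_timelike (F.toEquiv p) hv
  have hH : φ (φ.symm (.inl H)) = .inl H := φ.apply_symm_apply _
  refine ⟨φ.symm (.inl H), ⟨H, hH⟩, ?_, ?_⟩
  · rw [ev_eq hm, mem_event hH]
    exact ⟨0, by simp [Frame.toEquiv_apply, ho]⟩
  · rw [ev_eq hm, mem_event hH]
    refine ⟨properTime (F.toEquiv q - F.toEquiv p), ?_⟩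
    rw [Frame.toEquiv_apply H, map_smul, ho, hl, smul_smul,
      mul_inv_cancel₀ (properTime_pos hv).ne', one_smul, add_sub_cancel]

/-- `Frame.normalized` gives the time unit of a frame `properTime` one, and homogeneity extends this
along its world-line. -/
theorem elapsedTime (hd : 3 ≤ d) {k : B} {F : Frame Q d} (hk : φ k = .inl F) {A E : Coord Q d}
    (hA : k ∈ event φ A) (hE : k ∈ event φ E) (hAE : A ≠ E) :
    0 < mink (E - A) (E - A) ∧
      (frameModel φ).elapsedTime k (event φ A) (event φ E) (properTime (E - A)) ∧
      ∀ t : Q, k ∈ event φ (A + t • (E - A)) := by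
  simp only [mem_event hk] at hA hE ⊢
  obtain ⟨s, rfl⟩ := hA
  obtain ⟨t, rfl⟩ := hE
  have hst : t - s ≠ 0 := fun h => hAE (by rw [sub_eq_zero.1 h])
  rw [Frame.toEquiv_sub, ← sub_smul, map_smul, mink_smul_self]
  refine ⟨mul_pos (sq_pos_of_ne_zero hst) F.pos,
    ⟨s • unitTime, t • unitTime, ?_, ?_, ?_⟩, fun r => ⟨s + r * (t - s), ?_⟩⟩
  · rw [loc_iff hd hk, Equiv.symm_apply_apply]
  · rw [loc_iff hd hk, Equiv.symm_apply_apply]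
  · rw [properTime_smul _ F.pos.le, show properTime (F.linear unitTime) = 1 from F.normalized,
      abs_sub_comm]
    simp [timeComp, unitTime]
  · rw [Frame.toEquiv_apply, Frame.toEquiv_apply, map_smul, map_smul, add_smul, mul_smul, add_assoc]

theorem cp (hd : 3 ≤ d) : (frameModel φ).CP := by
  rintro m ⟨F, hm⟩ a ⟨Fa, ha⟩ b ⟨Fb, hb⟩ c ⟨Fc, hc⟩ ea hea e he ec hec ⟨ha', hb', hc', hbe, htime⟩
  rw [mem_Ev hm] at hea he hec
  obtain ⟨-, A, rfl⟩ := hea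
  obtain ⟨-, E, rfl⟩ := he
  obtain ⟨-, C, rfl⟩ := hec
  have hlt : ∀ x y, (frameModel φ).timeLT m (event φ x) (event φ y) →
      0 < (F.linear.symm (y - x)) 0 := by
    rintro x y ⟨p, q, hp, hq, h⟩
    rw [loc_iff hd hm] at hp hq
    subst hp hq
    rw [← Frame.symm_toEquiv_sub]
    exact sub_pos.2 h
  obtain ⟨hpos, hAE, hEC, hAC⟩ : 0 < (F.linear.symm (E - A)) 0 * (F.linear.symm (C - E)) 0 ∧
      A ≠ E ∧ E ≠ C ∧ A ≠ C := by
    have hpos : 0 < (F.linear.symm (E - A)) 0 * (F.linear.symm (C - E)) 0 := by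
      rcases htime with ⟨h₁, h₂⟩ | ⟨h₁, h₂⟩
      · exact mul_pos (hlt _ _ h₁) (hlt _ _ h₂)
      · have k₁ := hlt _ _ h₁
        have k₂ := hlt _ _ h₂
        rw [← neg_sub E A, map_neg, Pi.neg_apply] at k₁
        rw [← neg_sub C E, map_neg, Pi.neg_apply] at k₂
        exact mul_pos_of_neg_of_neg (by linarith) (by linarith)
    refine ⟨hpos, ?_, ?_, ?_⟩
    · rintro rfl; simp at hpos
    · rintro rfl; simp at hpos
    · rintro rfl
      rw [← neg_sub, map_neg, Pi.neg_apply] at hpos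
      nlinarith [sq_nonneg ((F.linear.symm (A - E)) 0)]
  obtain ⟨h₁, t₁, -⟩ := elapsedTime hd ha ha'.1 ha'.2 hAE
  obtain ⟨h₂, t₂, -⟩ := elapsedTime hd hc hc'.1 hc'.2 hEC
  obtain ⟨-, t₃, hline⟩ := elapsedTime hd hb hb'.1 hb'.2 hAC
  -- The order of events is given in the coordinates of `m`, which may reverse time. The sign of the
  -- product of the two legs is unaffected by the similarity and transfers to the reference system.
  have ho : 0 < mink (E - A) (C - E) := by
    have e₁ := F.mink_linear_linear (F.linear.symm (E - A)) (F.linear.symm (E - A))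
    have e₂ := F.mink_linear_linear (F.linear.symm (C - E)) (F.linear.symm (C - E))
    have e₃ := F.mink_linear_linear (F.linear.symm (E - A)) (F.linear.symm (C - E))
    simp only [LinearEquiv.apply_symm_apply] at e₁ e₂ e₃
    rw [e₃]
    refine mul_pos ((mink_pos_iff ?_ ?_).2 hpos) F.pos
    · exact pos_of_mul_pos_left (e₁ ▸ h₁) F.pos.le
    · exact pos_of_mul_pos_left (e₂ ▸ h₂) F.pos.le
  refine ⟨_, _, _, t₁, t₂, t₃, ?_⟩
  have hs := sqrt_mink_add_lt_of_avoid h₁ h₂ ho fun t ht => hbe (by rw [ht]; exact hline t)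
  have hsign := (mink_pos_iff h₁ h₂).1 ho
  -- Equal orientation of the legs makes the extra clock term exactly additive, so strictness comes
  -- from the Minkowski term.
  have habs : |(C - A) 0| = |(E - A) 0| + |(C - E) 0| := by
    rw [← sub_add_sub_cancel' E A C, Pi.add_apply]
    rcases pos_and_pos_or_neg_and_neg_of_mul_pos hsign with ⟨i, j⟩ | ⟨i, j⟩
    · rw [abs_of_pos i, abs_of_pos j, abs_of_pos (add_pos i j)]
    · rw [abs_of_neg i, abs_of_neg j, abs_of_neg (add_neg i j)]; ring
  rw [properTime, properTime, properTime, habs]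
  linarith

/-- Under the symmetric distance axiom, two frames with a common origin and a common orthogonal
spatial vector have the same scale. -/
theorem scale_eq (hd : 3 ≤ d) (h : (frameModel φ).AxSymDist) {F G : Frame Q d}
    (hF : F.origin = 0) (hG : G.origin = 0) {e : Coord Q d} (he : mink e e ≠ 0)
    (heF : mink e (F.linear unitTime) = 0) (heG : mink e (G.linear unitTime) = 0) :
    mink (F.linear unitTime) (F.linear unitTime) =
      mink (G.linear unitTime) (G.linear unitTime) := by
  have hφ : ∀ H : Frame Q d, φ (φ.symm (.inl H)) = .inl H := fun H => φ.apply_symm_apply _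
  have h0 : ∀ H : Frame Q d, H.origin = 0 → ∀ x, H.toEquiv x = H.linear x := fun H hH x => by
    rw [Frame.toEquiv_apply, hH, zero_add]
  have hs : ∀ H : Frame Q d, H.origin = 0 → ∀ x, H.toEquiv.symm x = H.linear.symm x :=
    fun H hH x => by rw [Equiv.symm_apply_eq, h0 H hH, LinearEquiv.apply_symm_apply]
  have htime : ∀ H : Frame Q d, mink e (H.linear unitTime) = 0 → H.linear.symm e 0 = 0 := by
    intro H hH
    have := H.mink_linear_linear (H.linear.symm e) unitTime
    rw [LinearEquiv.apply_symm_apply, hH, eq_comm, mul_eq_zero, or_iff_left H.pos.ne',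
      mink_comm, mink_unitTime_left] at this
    exact this
  have hmem : ∀ x, event φ x ∈ (frameModel φ).Ev (φ.symm (.inl F)) ∩
      (frameModel φ).Ev (φ.symm (.inl G)) := fun x => by
    rw [Set.mem_inter_iff, mem_Ev (hφ F), mem_Ev (hφ G)]
    exact ⟨⟨event_nonempty hd x, x, rfl⟩, ⟨event_nonempty hd x, x, rfl⟩⟩
  have hsim : ∀ H : Frame Q d, H.origin = 0 → mink e (H.linear unitTime) = 0 →
      (frameModel φ).simultaneous (φ.symm (.inl H)) (event φ 0) (event φ e) := by
    intro H hH he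
    refine ⟨0, H.linear.symm e, ?_, ?_, (htime H he).symm⟩
    · rw [ev_eq (hφ H), h0 H hH, map_zero]
    · rw [ev_eq (hφ H), h0 H hH, LinearEquiv.apply_symm_apply]
  obtain ⟨x, h₁, h₂⟩ := h _ ⟨F, hφ F⟩ _ ⟨G, hφ G⟩ _ (hmem 0) _ (hmem e) (hsim F hF heF)
    (hsim G hG heG)
  have hdist : ∀ H : Frame Q d, H.origin = 0 → mink e (H.linear unitTime) = 0 →
      (frameModel φ).distance (φ.symm (.inl H)) (event φ 0) (event φ e) x →
      mink (H.linear.symm e) (H.linear.symm e) = - x ^ 2 := by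
    rintro H hH he ⟨p, q, hp, hq, rfl⟩
    rw [loc_iff hd (hφ H), hs H hH] at hp hq
    rw [map_zero] at hp
    subst hp hq
    have ht := htime H he
    rw [length_spaceComp_eq (by simpa [timeComp] using ht.symm), ← mink_sub_self_comm,
      sub_zero, sq_sqrt, neg_neg]
    exact neg_nonneg.2 (mink_self_nonpos ht)
  -- Both frames assign `e` the length `x`, so `mink e e` is `-x ^ 2` times the scale of either
  -- frame.
  have k₁ := F.mink_linear (F.linear.symm e)
  have k₂ := G.mink_linear (G.linear.symm e)
  rw [LinearEquiv.apply_symm_apply, hdist F hF heF h₁] at k₁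
  rw [LinearEquiv.apply_symm_apply, hdist G hG heG h₂] at k₂
  have hx : - x ^ 2 ≠ 0 := fun hx => he (by rw [k₁, hx, zero_mul])
  exact mul_left_cancel₀ hx (k₁.symm.trans k₂)

theorem not_axSymDist (hd : 3 ≤ d) : ¬ (frameModel φ).AxSymDist := by
  intro h
  let i : Fin d := ⟨1, by omega⟩
  let j : Fin d := ⟨2, by omega⟩
  have hi : i ≠ 0 := by simp [i, Fin.ext_iff]
  have hj : j ≠ 0 := by simp [j, Fin.ext_iff]
  have hij : i ≠ j := by simp [i, j, Fin.ext_iff]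
  -- The triple 3, 4, 5 keeps square roots rational: the clock values are `1 + 1 = 2` on the time
  -- unit and `4 + 5 = 9` on `v`. The scales are `1/4` and `16/81`, although axis `j` is orthogonal
  -- to both directions.
  let v : Coord Q d := (5 : Q) • unitTime + Pi.single i 3
  have hv : mink v v = 4 ^ 2 := by
    rw [mink_add_self, mink_smul_self, mink_unitTime, map_smul, LinearMap.smul_apply,
      mink_unitTime_single hi, mink_single_self hi, smul_zero]
    norm_num
  have hv0 : v 0 = 5 := by simp [v, unitTime, hi.symm]
  have hu : mink (unitTime : Coord Q d) unitTime = 1 ^ 2 := by rw [mink_unitTime]; ring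
  have hu0 : (unitTime : Coord Q d) 0 = 1 := by simp [unitTime]
  obtain ⟨F, hF, hF'⟩ := Frame.exists_of_timelike 0 (v := (unitTime : Coord Q d))
    (by rw [hu]; norm_num)
  obtain ⟨G, hG, hG'⟩ := Frame.exists_of_timelike 0 (v := v) (by rw [hv]; norm_num)
  have hs := scale_eq (φ := φ) hd h hF hG (e := Pi.single j 1)
    (by rw [mink_single_self hj]; norm_num)
    (by rw [hF', map_smul, mink_comm, mink_unitTime_single hj, smul_zero])
    (by rw [hG', map_smul, mink_comm, mink_single_right hj]; simp [v, unitTime, hj, hij.symm])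
  rw [hF', hG', mink_smul_self, mink_smul_self, properTime, properTime, hv, hv0, hu, hu0, sqrt_sq,
    sqrt_sq] at hs
  have h5 : |(5 : Q)| = 5 := abs_of_pos (by norm_num)
  have h4 : |(4 : Q)| = 4 := abs_of_pos (by norm_num)
  rw [abs_one, h5, h4] at hs
  norm_num at hs

end frameModel

end Frames

instance isEuclideanOrderedField_ulift_real : IsEuclideanOrderedField (ULift.{u} ℝ) where
  toIsStrictOrderedRing :=
    Function.Injective.isStrictOrderedRing ULift.down rfl rfl (fun _ _ => rfl) (fun _ _ => rfl)
      Iff.rfl Iff.rfl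
  isSquare_of_pos x hx := ⟨⟨√x.down⟩, ULift.down_injective (Real.mul_self_sqrt hx.le).symm⟩

end Kinematics

theorem mainTheorem6 (d : ℕ) [NeZero d] (hd : 3 ≤ d) :
    (∀ (Q : Type u) [Field Q] [LinearOrder Q] [Kinematics.IsEuclideanOrderedField Q]
        (B : Type v) (M : Kinematics.Model d Q B),
        M.SpecRel₀ → M.AxSymDist → M.CP) ∧
    (∃ (Q : Type u) (_ : Field Q) (_ : LinearOrder Q) (_ : Kinematics.IsEuclideanOrderedField Q)
        (B : Type v) (M : Kinematics.Model d Q B),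
        M.SpecRel₀ ∧ M.AxLinTime ∧ M.AxShift ∧ M.AxThExp ∧ M.CP ∧ ¬ M.AxSymDist) := by
  -- `ULift` places the reals in universe `u`, and `Shrink` places the bodies in the independent
  -- universe `v`.
  refine ⟨fun Q _ _ _ B M h hsym => h.cp hd hsym, ULift.{u} ℝ, inferInstance, inferInstance,
    inferInstance, Shrink.{v} (Kinematics.Frame (ULift.{u} ℝ) d ⊕ Kinematics.Ray (ULift.{u} ℝ) d),
    Kinematics.frameModel (equivShrink _).symm, ?_⟩
  open Kinematics.frameModel in
  exact ⟨⟨axSelf₀ hd, axPh hd, axEv⟩, axLinTime hd, axShift hd, axThExp, cp hd, not_axSymDist hd⟩
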